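/- Let $\mathbb H^3=\{(\zeta,w)\in\mathbb C\times\mathbb R: w>0\}$ with the metric $(|d\zeta|^2+dw^2)/w^2$ and asymptotic boundary $\bar{\mathbb C}=\mathbb C\cup\{\infty\}$. **Definitions.** A *Bryant surface* $\Sigma$ is an immersion $X:M\to\mathbb H^3$ of a connected surface with constant mean curvature one; $M$ is regarded as a Riemann surface, with the conformal structure of the induced metric and the orientation for which the mean curvature vector is the direct normal. It is a *2-catenoidal surface* if the induced metric is complete, $M$ has exactly two ends, and each end (more precisely, a neighbourhood of it in $M$) is embedded and has finite total curvature. Let $\mu\in(0,1)\cup(1,\infty)$. A *canonical catenoidal end* of growth $1-\mu$, asymptotic boundary $\infty$ and axis $(0,\infty)$ is an immersion $(\zeta,w)$ of a punctured disc $\{0<|z|<r\}$ into $\mathbb H^3$ of the form $$\zeta=\frac{\bar AC+\bar BD}{|A|^2+|B|^2},\qquad w=\frac1{|A|^2+|B|^2},$$ where $F=\begin{pmatrix}A&B\\ C&D\end{pmatrix}$ is a holomorphic map from the universal cover of the punctured disc to $\mathrm{SL}_2(\mathbb C)$, $$F=\begin{pmatrix} z^{\frac{1-\mu}2}f_2 &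 \frac{\mu-1}{\mu+1}z^{\frac{1+\mu}2}g_2\\[2pt] \frac{\mu^2-1}{4\mu}z^{\frac{-1-\mu}2}f_1 & \frac{(1+\mu)^2}{4\mu}z^{\frac{\mu-1}2}g_1\end{pmatrix},\qquad F^{-1}dF=\begin{pmatrix} g&-g^2\\ 1&-g\end{pmatrix}\omega,$$ with $g=z^\mu$, $\omega=z^{-1-\mu}h\,dz$, the functions $f_1,f_2,g_1,g_2,h$ holomorphic on $\{|z|<r\}$, $f_1(0)=f_2(0)=g_1(0)=g_2(0)=1$ and $f_1'(0)=0$. Let $\mathcal A\ne\mathcal B$ be points of $\bar{\mathbb C}$. An end $E$ of a 2-catenoidal surface is a *catenoidal end* of growth $1-\mu$, asymptotic boundary $\mathcal B$ and axis $(\mathcal A,\mathcal B)$ if some isometry of $\mathbb H^3$ (direct or not) maps $\mathcal A$ to $0$, $\mathcal B$ to $\infty$ and (a neighbourhood of the end in) $E$ to a canonical catenoidal end of growth $1-\mu$, asymptotic boundary $\infty$ and axis $(0,\infty)$. **Proposition.** Let $\Sigma$ be a 2-catenoidal surface. Assume that its ends $E_1$ and $E_2$ are catenoidal ends of growths $1-\mu_1$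 and $1-\mu_2$, of asymptotic boundaries $\mathcal B_1$ and $\mathcal B_2$, and of axes $(\mathcal A_1,\mathcal B_1)$ and $(\mathcal A_2,\mathcal B_2)$, where $\mu_1,\mu_2\in(0,1)\cup(1,\infty)$. Assume that $\mathcal B_1\neq\mathcal B_2$. Then $\mu_1=\mu_2$, $\mathcal A_1=\mathcal B_2$ and $\mathcal A_2=\mathcal B_1$; that is, the two ends have the same growth and the same axis up to orientation, but different asymptotic boundaries. -/

import Mathlib

open scoped Manifold ContDiff Topology Matrix

noncomputable section

namespace BryantSurface

/-- Hyperbolic 3-space in the upper half-space model: the points `(ζ, w)` with `ζ : ℂ`, `w > 0`. -/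
abbrev UpperHalfSpace : Type := {p : ℂ × ℝ // 0 < p.2}

/-- The hyperbolic metric `(|dζ|² + dw²) / w²` at the point `p`, on tangent vectors `U`, `V`. -/
def hypInner (p U V : ℂ × ℝ) : ℝ :=
  ((starRingEnd ℂ U.1 * V.1).re + U.2 * V.2) / p.2 ^ 2

/-- First partial derivative with respect to `x`, where `z = x + i y`. -/
def pdx {F : Type*} [NormedAddCommGroup F] [NormedSpace ℝ F] (Y : ℂ → F) : ℂ → F :=
  fun z => fderiv ℝ Y z 1

/-- First partial derivative with respect to `y`, where `z = x + i y`. -/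
def pdy {F : Type*} [NormedAddCommGroup F] [NormedSpace ℝ F] (Y : ℂ → F) : ℂ → F :=
  fun z => fderiv ℝ Y z Complex.I

/-- The usual vector product of `ℂ × ℝ = ℝ³` (with its standard orientation). -/
def cross (U V : ℂ × ℝ) : ℂ × ℝ :=
  (Complex.I * ((U.2 : ℂ) * V.1 - (V.2 : ℂ) * U.1), (starRingEnd ℂ U.1 * V.1).im)

/-- The Levi-Civita connection of the hyperbolic metric: `D` is the flat derivative of the field
`V` in the direction `U`, and the result is the covariant derivative `∇_U V` at `p`. The metric is
the conformal change `e^{2σ}` of the flat one with `σ = - log w`. -/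
def covDeriv (p U V D : ℂ × ℝ) : ℂ × ℝ :=
  D - (U.2 / p.2) • V - (V.2 / p.2) • U + ((0 : ℂ), p.2 * hypInner p U V)

/-- Coefficient `⟨Y_x, Y_x⟩` of the first fundamental form of a parametrized surface in `ℍ³`. -/
def coeffE (Y : ℂ → ℂ × ℝ) (z : ℂ) : ℝ := hypInner (Y z) (pdx Y z) (pdx Y z)

/-- Coefficient `⟨Y_x, Y_y⟩` of the first fundamental form. -/
def coeffF (Y : ℂ → ℂ × ℝ) (z : ℂ) : ℝ := hypInner (Y z) (pdx Y z) (pdy Y z)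

/-- Coefficient `⟨Y_y, Y_y⟩` of the first fundamental form. -/
def coeffG (Y : ℂ → ℂ × ℝ) (z : ℂ) : ℝ := hypInner (Y z) (pdy Y z) (pdy Y z)

/-- The unit normal `N` such that `(∂Y/∂x, ∂Y/∂y, N)` is direct. -/
def unitNormal (Y : ℂ → ℂ × ℝ) (z : ℂ) : ℂ × ℝ :=
  (Real.sqrt (hypInner (Y z) (cross (pdx Y z) (pdy Y z)) (cross (pdx Y z) (pdy Y z))))⁻¹ •
    cross (pdx Y z) (pdy Y z)

/-- Coefficient `⟨∇_x Y_x, N⟩` of the second fundamental form, with `N` the `unitNormal`. -/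
def coeffL (Y : ℂ → ℂ × ℝ) (z : ℂ) : ℝ :=
  hypInner (Y z) (covDeriv (Y z) (pdx Y z) (pdx Y z) (pdx (pdx Y) z)) (unitNormal Y z)
/-- Coefficient `⟨∇_x Y_y, N⟩` of the second fundamental form. -/
def coeffM (Y : ℂ → ℂ × ℝ) (z : ℂ) : ℝ :=
  hypInner (Y z) (covDeriv (Y z) (pdx Y z) (pdy Y z) (pdx (pdy Y) z)) (unitNormal Y z)

/-- Coefficient `⟨∇_y Y_y, N⟩` of the second fundamental form. -/
def coeffN (Y : ℂ → ℂ × ℝ) (z : ℂ) : ℝ :=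
  hypInner (Y z) (covDeriv (Y z) (pdy Y z) (pdy Y z) (pdy (pdy Y) z)) (unitNormal Y z)

/-- The mean curvature: half the trace of the second fundamental form. -/
def meanCurvature (Y : ℂ → ℂ × ℝ) (z : ℂ) : ℝ :=
  (coeffE Y z * coeffN Y z - 2 * coeffF Y z * coeffM Y z + coeffG Y z * coeffL Y z) /
    (2 * (coeffE Y z * coeffG Y z - coeffF Y z ^ 2))

/-- The Gauss curvature of the induced metric of a conformal parametrization, whose metric is
`coeffE |dz|²`: `K = - Δ (log coeffE) / (2 coeffE)`. -/
def gaussCurvature (Y : ℂ → ℂ × ℝ) (z : ℂ) : ℝ :=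
  -(pdx (pdx fun v => Real.log (coeffE Y v)) z + pdy (pdy fun v => Real.log (coeffE Y v)) z) /
    (2 * coeffE Y z)

/-- `Y` is, on the open set `U`, a smooth conformal immersion into `ℍ³` of mean curvature one.
The orientation of `U` is the one for which the mean curvature vector is the direct normal. -/
structure IsBryantPatch (Y : ℂ → ℂ × ℝ) (U : Set ℂ) : Prop where
  smooth : ContDiffOn ℝ ∞ Y U
  immersion : ∀ z ∈ U, 0 < coeffE Y z
  conformal : ∀ z ∈ U, coeffE Y z = coeffG Y z ∧ coeffF Y z = 0
  mean_one : ∀ z ∈ U, meanCurvature Y z = 1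

section Surface

variable {M : Type*} [TopologicalSpace M]

/-- The set `S` is relatively compact. -/
def RelCompact (S : Set M) : Prop := ∃ K : Set M, IsCompact K ∧ S ⊆ K

/-- The open connected set `E` represents exactly one end of `M`: outside any compact set it has
exactly one connected component that is not relatively compact. -/
structure IsEnd (E : Set M) : Prop where
  isOpen : IsOpen E
  isConnected : IsConnected E
  one_end : ∀ K : Set M, IsCompact K →
    ∃! C : Set M, (∃ x ∈ E \ K, C = connectedComponentIn (E \ K) x) ∧ ¬ RelCompact C

variable [ChartedSpace ℂ M]

/-- The expression of a map `X : M → ℍ³` in the preferred chart of `M` at `p`. -/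
def inChart (X : M → UpperHalfSpace) (p : M) (z : ℂ) : ℂ × ℝ :=
  (X ((chartAt ℂ p).symm z)).1

/-- An immersed Bryant surface: a conformal immersion of constant mean curvature one of a Riemann
surface into `ℍ³`. The Riemann surface structure is the one given by the induced metric and by the
orientation defined by the mean curvature vector. -/
def IsBryantSurface (X : M → UpperHalfSpace) : Prop :=
  ∀ p : M, IsBryantPatch (inChart X p) (chartAt ℂ p).target

/-- The induced metric is complete: every divergent `C¹` curve has infinite length. The induced
length of a curve `γ` of `M` is the hyperbolic length of `X ∘ γ`. -/
def IsCompleteSurface (X : M → UpperHalfSpace) : Prop :=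
  ∀ γ : ℝ → M, ContMDiffOn 𝓘(ℝ) 𝓘(ℝ, ℂ) 1 γ (Set.Ici 0) →
    Filter.Tendsto γ Filter.atTop (Filter.cocompact M) →
    ∫⁻ t in Set.Ici (0 : ℝ), ENNReal.ofReal (Real.sqrt (hypInner (X (γ t)).1
      (deriv (fun s => (X (γ s)).1) t) (deriv (fun s => (X (γ s)).1) t))) = ⊤

/-- The total curvature `∫ |K| dA` over `E` is finite. The integral is the supremum of the sums of
its values over finite families of disjoint compact pieces of `E`, each one in a chart domain. -/
def HasFiniteTotalCurvature (X : M → UpperHalfSpace) (E : Set M) : Prop :=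
  ∃ C : ℝ, ∀ (m : ℕ) (p : Fin m → M) (S : Fin m → Set M),
    (∀ i, IsCompact (S i) ∧ S i ⊆ E ∩ (chartAt ℂ (p i)).source) →
    Pairwise (fun i j => Disjoint (S i) (S j)) →
    ∑ i, ∫⁻ z in chartAt ℂ (p i) '' S i,
      ENNReal.ofReal (|gaussCurvature (inChart X (p i)) z| * coeffE (inChart X (p i)) z) ≤
        ENNReal.ofReal C

/-- `X` is a complete immersed Bryant surface that has exactly `n` ends, represented by
`E 0, …, E (n - 1)`, and each of these ends is embedded and of finite total curvature. -/
structure IsCatenoidalSurface (n : ℕ) (X : M → UpperHalfSpace) (E : Fin n → Set M) : Prop where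
  bryant : IsBryantSurface X
  complete : IsCompleteSurface X
  isEnd : ∀ i, IsEnd (E i)
  disjoint : Pairwise fun i j => Disjoint (E i) (E j)
  compact_compl : IsCompact (⋃ i, E i)ᶜ
  embedded : ∀ i, Topology.IsEmbedding (fun x : E i => X x)
  finiteTotalCurvature : ∀ i, HasFiniteTotalCurvature X (E i)

/-- The disc of radius `r` about `0`, without its centre. -/
def puncturedDisc (r : ℝ) : Set ℂ := Metric.ball 0 r \ {0}

/-- `φ` is a conformal parametrization of the end `E` (up to a relatively compact part of `E`) by
a punctured disc, in which the puncture corresponds to the end. -/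
structure IsEndParametrization (E : Set M) (r : ℝ) (φ : ℂ → M) : Prop where
  pos : 0 < r
  holomorphic : MDifferentiableOn 𝓘(ℂ) 𝓘(ℂ) φ (puncturedDisc r)
  injOn : Set.InjOn φ (puncturedDisc r)
  mapsTo : Set.MapsTo φ (puncturedDisc r) E
  tendsto : Filter.Tendsto φ (𝓝[≠] 0) (Filter.cocompact M)
  covers : ∀ s : ℝ, 0 < s → s < r → RelCompact (E \ φ '' puncturedDisc s)

end Surface

/-- The hermitian matrix of determinant one (Minkowski model) that corresponds to `(ζ, w)`. -/
def toHermitian (p : ℂ × ℝ) : Matrix (Fin 2) (Fin 2) ℂ :=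
  !![1 / (p.2 : ℂ), starRingEnd ℂ p.1 / p.2; p.1 / p.2, p.2 + p.1 * starRingEnd ℂ p.1 / p.2]

/-- The point `(ζ, w)` that corresponds to a hermitian matrix `N`. For `N = F F*` with
`F = (A B; C D)` it is `ζ = (Ā C + B̄ D) / (|A|² + |B|²)`, `w = 1 / (|A|² + |B|²)`. -/
def ofHermitian (N : Matrix (Fin 2) (Fin 2) ℂ) : ℂ × ℝ :=
  (N 1 0 / N 0 0, 1 / (N 0 0).re)

/-- The isometries of `ℍ³`. The direct ones are the maps `N ↦ P N P*` of the Minkowski model with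
`P ∈ SL₂(ℂ)`; an indirect one (`c = true`) is a direct one after the symmetry `(ζ, w) ↦ (ζ̄, w)`. -/
def isometry (P : Matrix.SpecialLinearGroup (Fin 2) ℂ) (c : Bool) (p : ℂ × ℝ) : ℂ × ℝ :=
  ofHermitian (P.1 * toHermitian (if c then (starRingEnd ℂ p.1, p.2) else p) * P.1ᴴ)

/-- The action `ζ ↦ (δ ζ + γ) / (β ζ + α)` on the Riemann sphere of `P = (α β; γ δ)`. -/
def moebius (P : Matrix.SpecialLinearGroup (Fin 2) ℂ) : OnePoint ℂ → OnePoint ℂ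
  | none => if P.1 0 1 = 0 then OnePoint.infty else ((P.1 1 1 / P.1 0 1 : ℂ) : OnePoint ℂ)
  | some ζ => if P.1 0 1 * ζ + P.1 0 0 = 0 then OnePoint.infty
      else (((P.1 1 1 * ζ + P.1 1 0) / (P.1 0 1 * ζ + P.1 0 0) : ℂ) : OnePoint ℂ)

/-- The action on the asymptotic boundary `ℂ ∪ {∞}` of the isometry `isometry P c`. -/
def boundaryMap (P : Matrix.SpecialLinearGroup (Fin 2) ℂ) (c : Bool) (x : OnePoint ℂ) :
    OnePoint ℂ :=
  moebius P (if c then OnePoint.map (starRingEnd ℂ) x else x)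

/-- The canonical Bryant representation of a catenoidal end, as a function of a logarithm `t` of
`z = exp t`, that is, on the universal cover of a punctured disc:
`A = z^{(1-μ)/2} f₂`, `B = (μ-1)/(μ+1) z^{(1+μ)/2} g₂`,
`C = (μ²-1)/(4μ) z^{(-1-μ)/2} f₁`, `D = (1+μ)²/(4μ) z^{(μ-1)/2} g₁`. -/
def canonicalFrame (μ : ℝ) (f₁ f₂ g₁ g₂ : ℂ → ℂ) (t : ℂ) : Matrix (Fin 2) (Fin 2) ℂ :=
  !![Complex.exp ((1 - μ) / 2 * t) * f₂ (Complex.exp t),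
      (μ - 1) / (μ + 1) * Complex.exp ((1 + μ) / 2 * t) * g₂ (Complex.exp t);
    (μ ^ 2 - 1) / (4 * μ) * Complex.exp ((-1 - μ) / 2 * t) * f₁ (Complex.exp t),
      (1 + μ) ^ 2 / (4 * μ) * Complex.exp ((μ - 1) / 2 * t) * g₁ (Complex.exp t)]

/-- The matrix of `F⁻¹ dF` for the Weierstrass data `(g, η)`. -/
def weierstrassMatrix (g η : ℂ) : Matrix (Fin 2) (Fin 2) ℂ :=
  η • !![g, -g ^ 2; 1, -g]

/-- `Y`, defined on the punctured disc of radius `r`, is a canonical catenoidal end of growth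
`1 - μ`, of asymptotic boundary `∞` and of axis `(Z, ∞)`. Its Weierstrass data are `g = z^μ` and
`ω = z^{-1-μ} h dz`; with `z = exp t` the latter is `exp (-μ t) h (exp t) dt`. -/
def IsCanonicalCatenoidalEnd (μ : ℝ) (Z : ℂ) (r : ℝ) (Y : ℂ → ℂ × ℝ) : Prop :=
  0 < μ ∧ μ ≠ 1 ∧ 0 < r ∧
  ∃ f₁ f₂ g₁ g₂ h : ℂ → ℂ,
    DifferentiableOn ℂ f₁ (Metric.ball 0 r) ∧ DifferentiableOn ℂ f₂ (Metric.ball 0 r) ∧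
    DifferentiableOn ℂ g₁ (Metric.ball 0 r) ∧ DifferentiableOn ℂ g₂ (Metric.ball 0 r) ∧
    DifferentiableOn ℂ h (Metric.ball 0 r) ∧
    f₁ 0 = 1 ∧ f₂ 0 = 1 ∧ g₁ 0 = 1 ∧ g₂ 0 = 1 ∧
    Z = ((μ : ℂ) ^ 2 - 1) / (4 * μ) * deriv f₁ 0 ∧
    ∀ t : ℂ, Complex.exp t ∈ Metric.ball (0 : ℂ) r →
      (canonicalFrame μ f₁ f₂ g₁ g₂ t).det = 1 ∧
      (∀ i j, HasDerivAt (fun s => canonicalFrame μ f₁ f₂ g₁ g₂ s i j)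
        ((canonicalFrame μ f₁ f₂ g₁ g₂ t * weierstrassMatrix (Complex.exp (μ * t))
          (Complex.exp (-μ * t) * h (Complex.exp t))) i j) t) ∧
      Y (Complex.exp t) = ofHermitian
        (canonicalFrame μ f₁ f₂ g₁ g₂ t * (canonicalFrame μ f₁ f₂ g₁ g₂ t)ᴴ)

/-- The end `E` of the Bryant surface `X` is a catenoidal end of growth `1 - μ`, of asymptotic
boundary `b` and of axis `(a, b)`: an isometry of `ℍ³`, direct or not, maps `a` to `0`, `b` to `∞`
and `E` to a canonical catenoidal end of growth `1 - μ` and axis `(0, ∞)`. An indirect isometry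
reverses the orientation of the surface, so in that case the conformal parameters of `E` and of
its image are conjugate to each other. -/
def IsCatenoidalEnd {M : Type*} [TopologicalSpace M] [ChartedSpace ℂ M]
    (X : M → UpperHalfSpace) (E : Set M) (μ : ℝ) (a b : OnePoint ℂ) : Prop :=
  a ≠ b ∧
  ∃ (P : Matrix.SpecialLinearGroup (Fin 2) ℂ) (c : Bool),
    boundaryMap P c a = ((0 : ℂ) : OnePoint ℂ) ∧ boundaryMap P c b = OnePoint.infty ∧
    ∃ (r : ℝ) (φ : ℂ → M) (Y : ℂ → ℂ × ℝ),
      IsEndParametrization E r φ ∧ IsCanonicalCatenoidalEnd μ 0 r Y ∧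
      ∀ z ∈ puncturedDisc r,
        isometry P c (X (φ z)).1 = Y (if c then starRingEnd ℂ z else z)

end BryantSurface

end

noncomputable section

namespace BryantSurface

/-! ### Wirtinger calculus, and the vanishing of the integral of a compactly supported `∂̄u`. -/

section

open MeasureTheory Complex

/-! The proof is a conservation law. A point of `ℍ³` is a hermitian matrix `N` of determinant one,
and on a surface of mean curvature one the matrix-valued (1,0)-form `α = ∂N · N⁻¹` is holomorphic
(`IsBryantPatch.differentiableOn_fluxForm`). Where `N = F F*` with `F` holomorphic, `α = dF · F⁻¹`;
unlike the frame `F`, the form `α` is single-valued on `M`. A direct isometry `N ↦ P N P*` merely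
conjugates `α` by `P`, and an indirect one adds a complex conjugation.

At a canonical end the expansion of `F` shows that `α` has at most a double pole, with residue `(1 -
μ²)/4 · diag(1, -1)`. The off-diagonal residue vanishes because `f₁'(0) = 0`: this is how the axis
enters. Hence an end of axis `(a, b)` has residue `c S`, where `c = (1 - μ²)/4` and `S` has
eigenvalue `1` on the line `a` and `-1` on the line `b`, points of the sphere being seen as lines of
`ℂ²` (`IsCatenoidalEnd.exists_residue`).

The complement of the ends is compact, so the residue theorem gives `c₁ S₁ + c₂ S₂ = 0`
(`sum_residue_eq_zero`). It is proved without contours. Take a smooth `ρ` with compact support that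
equals `1` away from the punctures. Stokes' theorem, applied chart by chart to a partition of unity,
gives `∫ ∂̄ρ ∧ α = 0` (`sum_integral_fluxDensity_eq_zero`). The integrand lives in the punctured
discs, and each disc contributes `π` times a residue (`integral_wirtBar_residue`).

What is left is linear algebra (`axes_eq_of_flux_add_eq_zero`). As `c₁ ≠ 0`, the matrices `S₁` and
`S₂` are proportional and have the same eigenlines. Since `ℬ₁ ≠ ℬ₂`, these are exchanged: `𝒜₁ = ℬ₂`,
`𝒜₂ = ℬ₁`, so `S₂ = -S₁` and `c₁ = c₂`. Thus `μ₁² = μ₂²`, and both growth parameters are positive.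
-/

/-- The Wirtinger derivative `∂f/∂z`. -/
def wirt (f : ℂ → ℂ) (z : ℂ) : ℂ := (fderiv ℝ f z 1 - I * fderiv ℝ f z I) / 2

/-- The Wirtinger derivative `∂f/∂z̄`. -/
def wirtBar (f : ℂ → ℂ) (z : ℂ) : ℂ := (fderiv ℝ f z 1 + I * fderiv ℝ f z I) / 2

lemma differentiableAt_of_wirtBar_eq_zero {f : ℂ → ℂ} {z : ℂ} (hf : DifferentiableAt ℝ f z)
    (h : wirtBar f z = 0) : DifferentiableAt ℂ f z := by
  rw [differentiableAt_complex_iff_differentiableAt_real]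
  refine ⟨hf, ?_⟩
  have h2 : fderiv ℝ f z 1 + I * fderiv ℝ f z I = 0 := by
    simpa [wirtBar] using h
  rw [smul_eq_mul]
  linear_combination (-I) * h2 - fderiv ℝ f z I * (-I_sq)

lemma fderiv_real_apply_of_hasDerivAt {f : ℂ → ℂ} {f' z : ℂ} (hf : HasDerivAt f f' z) (v : ℂ) :
    fderiv ℝ f z v = f' * v := by
  rw [hf.hasFDerivAt.restrictScalars ℝ |>.fderiv]
  simp [mul_comm]

lemma wirt_of_hasDerivAt {f : ℂ → ℂ} {f' z : ℂ} (hf : HasDerivAt f f' z) : wirt f z = f' := by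
  rw [wirt, fderiv_real_apply_of_hasDerivAt hf, fderiv_real_apply_of_hasDerivAt hf]
  linear_combination (-f' / 2) * I_sq

lemma wirtBar_of_hasDerivAt {f : ℂ → ℂ} {f' z : ℂ} (hf : HasDerivAt f f' z) :
    wirtBar f z = 0 := by
  rw [wirtBar, fderiv_real_apply_of_hasDerivAt hf, fderiv_real_apply_of_hasDerivAt hf]
  linear_combination (f' / 2) * I_sq

lemma fderiv_apply_eq (L : ℂ →L[ℝ] ℂ) (v : ℂ) : L v = v.re * L 1 + v.im * L I := by
  conv_lhs => rw [← re_add_im v]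
  have h1 : ((v.re : ℂ)) = v.re • (1 : ℂ) := by simp
  have h2 : ((v.im : ℂ)) * I = v.im • I := by simp
  rw [map_add, h1, h2, map_smul, map_smul]
  simp

lemma wirt_comp {f τ : ℂ → ℂ} {τ' z : ℂ} (hf : DifferentiableAt ℝ f (τ z))
    (hτ : HasDerivAt τ τ' z) : wirt (fun v => f (τ v)) z = τ' * wirt f (τ z) := by
  have h := (hf.hasFDerivAt.comp z (hτ.hasFDerivAt.restrictScalars ℝ)).fderiv
  change fderiv ℝ (fun v => f (τ v)) z = _ at h
  rw [wirt, wirt, h]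
  simp only [ContinuousLinearMap.comp_apply, ContinuousLinearMap.coe_restrictScalars',
    ContinuousLinearMap.toSpanSingleton_apply, smul_eq_mul]
  rw [fderiv_apply_eq _ (1 * τ'), fderiv_apply_eq _ (I * τ')]
  conv_rhs => rw [← re_add_im τ']
  simp only [one_mul, mul_re, mul_im, I_re, I_im, zero_mul, zero_sub, one_mul, zero_add, ofReal_neg]
  linear_combination ((-τ'.im * fderiv ℝ f (τ z) I) / 2 + (τ'.re : ℂ) * 0 + 2 * (τ'.im * fderiv ℝ f (τ z) I) / 2 ) * I_sq

/-- A holomorphic change of variable preserves types: `∂` is multiplied by `τ'` and `∂̄` by its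
conjugate. The product of the two factors is the real Jacobian `|τ'|²`, which makes integrals of
(1,1)-forms independent of the parameter. -/
lemma wirtBar_comp {f τ : ℂ → ℂ} {τ' z : ℂ} (hf : DifferentiableAt ℝ f (τ z))
    (hτ : HasDerivAt τ τ' z) :
    wirtBar (fun v => f (τ v)) z = (starRingEnd ℂ) τ' * wirtBar f (τ z) := by
  have h := (hf.hasFDerivAt.comp z (hτ.hasFDerivAt.restrictScalars ℝ)).fderiv
  change fderiv ℝ (fun v => f (τ v)) z = _ at h
  rw [wirtBar, wirtBar, h]
  simp only [ContinuousLinearMap.comp_apply, ContinuousLinearMap.coe_restrictScalars',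
    ContinuousLinearMap.toSpanSingleton_apply, smul_eq_mul]
  rw [fderiv_apply_eq _ (1 * τ'), fderiv_apply_eq _ (I * τ')]
  have : (starRingEnd ℂ) τ' = τ'.re - τ'.im * I := by
    apply Complex.ext <;> simp
  rw [this]
  simp only [one_mul, mul_re, mul_im, I_re, I_im, zero_mul, zero_sub, one_mul, zero_add, ofReal_neg]
  linear_combination ((τ'.im * fderiv ℝ f (τ z) I) / 2) * I_sq

lemma wirt_mul {f g : ℂ → ℂ} {z : ℂ} (hf : DifferentiableAt ℝ f z) (hg : DifferentiableAt ℝ g z) :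
    wirt (fun v => f v * g v) z = wirt f z * g z + f z * wirt g z := by
  simp only [wirt, fderiv_fun_mul hf hg, add_apply, smul_apply,
    smul_eq_mul]
  ring

lemma wirtBar_mul {f g : ℂ → ℂ} {z : ℂ} (hf : DifferentiableAt ℝ f z)
    (hg : DifferentiableAt ℝ g z) :
    wirtBar (fun v => f v * g v) z = wirtBar f z * g z + f z * wirtBar g z := by
  simp only [wirtBar, fderiv_fun_mul hf hg, add_apply,
    smul_apply, smul_eq_mul]
  ring

lemma wirt_add {f g : ℂ → ℂ} {z : ℂ} (hf : DifferentiableAt ℝ f z) (hg : DifferentiableAt ℝ g z) :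
    wirt (fun v => f v + g v) z = wirt f z + wirt g z := by
  simp only [wirt, fderiv_fun_add hf hg, add_apply]
  ring

lemma wirtBar_add {f g : ℂ → ℂ} {z : ℂ} (hf : DifferentiableAt ℝ f z)
    (hg : DifferentiableAt ℝ g z) :
    wirtBar (fun v => f v + g v) z = wirtBar f z + wirtBar g z := by
  simp only [wirtBar, fderiv_fun_add hf hg, add_apply]
  ring

lemma wirtBar_sub {f g : ℂ → ℂ} {z : ℂ} (hf : DifferentiableAt ℝ f z)
    (hg : DifferentiableAt ℝ g z) :
    wirtBar (fun v => f v - g v) z = wirtBar f z - wirtBar g z := by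
  simp only [wirtBar, fderiv_fun_sub hf hg, sub_apply]
  ring

lemma wirtBar_sum {ι : Type*} (s : Finset ι) {f : ι → ℂ → ℂ} {z : ℂ}
    (hf : ∀ i ∈ s, DifferentiableAt ℝ (f i) z) :
    wirtBar (fun v => ∑ i ∈ s, f i v) z = ∑ i ∈ s, wirtBar (f i) z := by
  simp only [wirtBar, fderiv_fun_sum hf, sum_apply]
  rw [← Finset.sum_div, Finset.sum_add_distrib, Finset.mul_sum]

lemma wirtBar_congr {f g : ℂ → ℂ} {z : ℂ} (h : f =ᶠ[𝓝 z] g) : wirtBar f z = wirtBar g z := by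
  simp only [wirtBar, h.fderiv_eq]

lemma wirt_congr {f g : ℂ → ℂ} {z : ℂ} (h : f =ᶠ[𝓝 z] g) : wirt f z = wirt g z := by
  simp only [wirt, h.fderiv_eq]

lemma wirtBar_const (c z : ℂ) : wirtBar (fun _ => c) z = 0 := by
  simp [wirtBar]

lemma wirtBar_ofReal {f : ℂ → ℝ} {z : ℂ} (h : fderiv ℝ f z = 0) (hf : DifferentiableAt ℝ f z) :
    wirtBar (fun v => (f v : ℂ)) z = 0 := by
  have : fderiv ℝ (fun v => (f v : ℂ)) z = 0 := by
    have h1 := (ofRealCLM.hasFDerivAt.comp z hf.hasFDerivAt).fderiv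
    change fderiv ℝ (fun v => (f v : ℂ)) z = _ at h1
    rw [h1, h]; simp
  simp [wirtBar, this]

lemma continuousOn_wirtBar {f : ℂ → ℂ} {U : Set ℂ} (hU : IsOpen U) (hf : ContDiffOn ℝ 1 f U) :
    ContinuousOn (wirtBar f) U := by
  have h := hf.continuousOn_fderiv_of_isOpen hU le_rfl
  unfold wirtBar
  fun_prop

lemma integral_fderiv_eq_zero {u : ℂ → ℂ} (hu : ContDiff ℝ 1 u) (hc : HasCompactSupport u) (v : ℂ) :
    ∫ z, fderiv ℝ u z v = 0 := by
  have hcont : Continuous (fun z => fderiv ℝ u z v) :=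
    (hu.continuous_fderiv one_ne_zero).clm_apply continuous_const
  -- Integration by parts against the constant `1`.
  have h := integral_mul_fderiv_eq_neg_fderiv_mul_of_integrable (𝕜 := ℂ) (f := fun _ : ℂ => (1 : ℂ))
    (g := u) (v := v) (μ := volume) (by simp)
    (by simpa using hcont.integrable_of_hasCompactSupport (hc.fderiv_apply (𝕜 := ℝ) v))
    (by simpa using hu.continuous.integrable_of_hasCompactSupport hc)
    (by simp) (fun x _ => hu.differentiable one_ne_zero x)
  simpa using h

lemma integral_wirtBar_eq_zero {u : ℂ → ℂ} (hu : ContDiff ℝ 1 u) (hc : HasCompactSupport u) :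
    ∫ z, wirtBar u z = 0 := by
  have hi : ∀ v, Integrable (fun z => fderiv ℝ u z v) := fun v =>
    ((hu.continuous_fderiv one_ne_zero).clm_apply continuous_const).integrable_of_hasCompactSupport
      (hc.fderiv_apply (𝕜 := ℝ) v)
  simp only [wirtBar]
  rw [integral_div, integral_add (hi 1) ((hi I).const_mul I), integral_const_mul,
    integral_fderiv_eq_zero hu hc, integral_fderiv_eq_zero hu hc]
  simp

/-- A function that is `C¹` on an open set `U` and vanishes on `U` off a compact subset of `U`
has `∫_U ∂f/∂z̄ = 0`. -/
lemma setIntegral_wirtBar_eq_zero {u : ℂ → ℂ} {U K : Set ℂ} (hU : IsOpen U) (hK : IsCompact K)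
    (hKU : K ⊆ U) (hu : ContDiffOn ℝ 1 u U) (h0 : ∀ z ∈ U, z ∉ K → u z = 0) :
    ∫ z in U, wirtBar u z = 0 := by
  classical
  -- The extension of `u` by zero is `C¹` on the whole plane, since `U` and the complement of `K`
  -- are open and cover it.
  set v : ℂ → ℂ := U.indicator u with hv
  have hvK : ∀ z, z ∉ K → v z = 0 := by
    intro z hz
    by_cases hzU : z ∈ U
    · simp [hv, hzU, h0 z hzU hz]
    · simp [hv, hzU]
  have hvU : ∀ z ∈ U, v =ᶠ[𝓝 z] u := fun z hz => by
    filter_upwards [hU.mem_nhds hz] with x hx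
    simp [hv, hx]
  have hvc : ∀ z, z ∉ K → v =ᶠ[𝓝 z] fun _ => 0 := fun z hz => by
    filter_upwards [hK.isClosed.isOpen_compl.mem_nhds hz] with x hx
    exact hvK x hx
  have hvd : ContDiff ℝ 1 v := by
    rw [contDiff_iff_contDiffAt]
    intro z
    by_cases hz : z ∈ K
    · exact (hu.contDiffAt (hU.mem_nhds (hKU hz))).congr_of_eventuallyEq (hvU z (hKU hz))
    · exact contDiffAt_const.congr_of_eventuallyEq (hvc z hz)
  have hcs : HasCompactSupport v := HasCompactSupport.intro hK fun x hx => hvK x hx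
  rw [setIntegral_congr_fun hU.measurableSet fun z hz => (wirtBar_congr (hvU z hz)).symm,
    setIntegral_eq_integral_of_forall_compl_eq_zero, integral_wirtBar_eq_zero hvd hcs]
  intro z hz
  rw [wirtBar_congr (hvc z fun h => hz (hKU h)), wirtBar_const]

lemma integrableOn_of_continuousOn_of_compact {f : ℂ → ℂ} {U K : Set ℂ} (hU : IsOpen U)
    (hK : IsCompact K) (hKU : K ⊆ U) (hf : ContinuousOn f U) (h0 : ∀ z ∈ U, z ∉ K → f z = 0) :
    IntegrableOn f U := by
  have h1 : IntegrableOn f K := (hf.mono hKU).integrableOn_compact hK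
  have h2 : IntegrableOn f (U \ K) := by
    refine (integrableOn_congr_fun (g := fun _ => (0 : ℂ)) (fun z hz => h0 z hz.1 hz.2)
      (hU.measurableSet.diff hK.measurableSet)).2 ?_
    exact integrableOn_zero
  have := h1.union h2
  rwa [Set.union_sdiff_cancel hKU] at this

end

/-! ### The mean curvature equation of a conformal patch. -/

section

open Complex

/-- The euclidean inner product of `ℂ × ℝ`. -/
def flatInner (U V : ℂ × ℝ) : ℝ := U.1.re * V.1.re + U.1.im * V.1.im + U.2 * V.2

lemma hypInner_eq (p U V : ℂ × ℝ) : hypInner p U V = flatInner U V / p.2 ^ 2 := by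
  simp [hypInner, flatInner]

lemma fderiv_flatInner {A B : ℂ → ℂ × ℝ} {z : ℂ} (hA : DifferentiableAt ℝ A z)
    (hB : DifferentiableAt ℝ B z) (v : ℂ) :
    fderiv ℝ (fun u => flatInner (A u) (B u)) z v =
      flatInner (fderiv ℝ A z v) (B z) + flatInner (A z) (fderiv ℝ B z v) := by
  have h (c : (ℂ × ℝ) →L[ℝ] ℝ) :=
    (c.hasFDerivAt.comp z hA.hasFDerivAt).mul (c.hasFDerivAt.comp z hB.hasFDerivAt)
  have h1 := h (reCLM ∘L ContinuousLinearMap.fst ℝ ℂ ℝ)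
  have h2 := h (imCLM ∘L ContinuousLinearMap.fst ℝ ℂ ℝ)
  have h3 := h (ContinuousLinearMap.snd ℝ ℂ ℝ)
  have h4 : fderiv ℝ (fun u => flatInner (A u) (B u)) z = _ := ((h1.add h2).add h3).fderiv
  rw [h4]
  simp [flatInner]
  ring

lemma pdy_pdx_comm {F : Type*} [NormedAddCommGroup F] [NormedSpace ℝ F] {Y : ℂ → F} {z : ℂ}
    (hY : ContDiffAt ℝ 2 Y z) : pdy (pdx Y) z = pdx (pdy Y) z := by
  have hd : DifferentiableAt ℝ (fderiv ℝ Y) z :=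
    (hY.fderiv_right (m := 1) (by norm_num)).differentiableAt one_ne_zero
  have h (v u : ℂ) : fderiv ℝ (fun x => fderiv ℝ Y x v) z u = fderiv ℝ (fderiv ℝ Y) z u v := by
    rw [fderiv_clm_apply hd (differentiableAt_const v)]; simp
  change fderiv ℝ (fun x => fderiv ℝ Y x 1) z I = fderiv ℝ (fun x => fderiv ℝ Y x I) z 1
  rw [h, h]
  exact (hY.isSymmSndFDerivAt (by simp)) _ _

lemma contDiffOn_pdx {F : Type*} [NormedAddCommGroup F] [NormedSpace ℝ F] {Y : ℂ → F} {U : Set ℂ}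
    (hU : IsOpen U) (hY : ContDiffOn ℝ ∞ Y U) : ContDiffOn ℝ ∞ (pdx Y) U :=
  (hY.fderiv_of_isOpen hU (by simp)).clm_apply contDiffOn_const

lemma contDiffOn_pdy {F : Type*} [NormedAddCommGroup F] [NormedSpace ℝ F] {Y : ℂ → F} {U : Set ℂ}
    (hU : IsOpen U) (hY : ContDiffOn ℝ ∞ Y U) : ContDiffOn ℝ ∞ (pdy Y) U :=
  (hY.fderiv_of_isOpen hU (by simp)).clm_apply contDiffOn_const

/-- In an orthogonal frame `a, b, a × b`, a vector is determined by its inner products. -/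
lemma eq_of_flatInner {V a b : ℂ × ℝ} (ha : 0 < flatInner a a) (hab : flatInner a b = 0)
    (hb : flatInner b b = flatInner a a) (h1 : flatInner V a = 0) (h2 : flatInner V b = 0)
    (s : ℝ) (h3 : flatInner V (cross a b) = s * flatInner a a ^ 2) :
    V = s • cross a b := by
  obtain ⟨⟨V1, V2⟩, V3⟩ := V
  obtain ⟨⟨a1, a2⟩, a3⟩ := a
  obtain ⟨⟨b1, b2⟩, b3⟩ := b
  simp only [flatInner, cross, mul_re, mul_im, I_re, I_im, sub_re, sub_im, ofReal_re, ofReal_im,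
    conj_re, conj_im, zero_mul, one_mul, zero_sub, sub_zero, add_zero, zero_add] at *
  set q := a1 * a1 + a2 * a2 + a3 * a3 with hq
  set c1 := a2 * b3 - a3 * b2 with hc1
  set c2 := a3 * b1 - a1 * b3 with hc2
  set c3 := a1 * b2 - a2 * b1 with hc3
  have hqq : q ^ 2 ≠ 0 := by positivity
  -- Lagrange's identity `|a × b|² = |a|²|b|² - (a·b)²`.
  have hcc : c1 ^ 2 + c2 ^ 2 + c3 ^ 2 = q ^ 2 := by
    linear_combination (b1 * b1 + b2 * b2 + b3 * b3 - q + q) * hq + q * hb -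
      (a1 * b1 + a2 * b2 + a3 * b3) * hab
  have h3' : V1 * c1 + V2 * c2 + V3 * c3 = s * q ^ 2 := by
    linear_combination h3
  -- Cramer's rule for the frame `a, b, c = a × b`: its determinant is `|c|² = q²`, and the
  -- coefficients below are the entries of `b × c`, `c × a` and `a × b`.
  have key (W1 W2 W3 : ℝ) (k1 : W1 * a1 + W2 * a2 + W3 * a3 = 0)
      (k2 : W1 * b1 + W2 * b2 + W3 * b3 = 0) (k3 : W1 * c1 + W2 * c2 + W3 * c3 = 0) :
      W1 = 0 ∧ W2 = 0 ∧ W3 = 0 := by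
    refine ⟨?_, ?_, ?_⟩ <;> refine (mul_eq_zero.1 (?_ : q ^ 2 * _ = 0)).resolve_left hqq <;>
      rw [← hcc]
    · linear_combination (b2 * c3 - b3 * c2) * k1 + (c2 * a3 - c3 * a2) * k2 + c1 * k3
    · linear_combination (b3 * c1 - b1 * c3) * k1 + (c3 * a1 - c1 * a3) * k2 + c2 * k3
    · linear_combination (b1 * c2 - b2 * c1) * k1 + (c1 * a2 - c2 * a1) * k2 + c3 * k3
  have hk := key (V1 - s * c1) (V2 - s * c2) (V3 - s * c3) (by linear_combination h1)
    (by linear_combination h2) (by linear_combination h3' - s * hcc)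
  refine Prod.ext (Complex.ext ?_ ?_) ?_
  · simp; linear_combination hk.1
  · simp; linear_combination hk.2.1
  · simp; linear_combination hk.2.2

/-- The mean curvature equation of a conformal patch. -/
lemma IsBryantPatch.laplacian {Y : ℂ → ℂ × ℝ} {U : Set ℂ} (hY : IsBryantPatch Y U) (hU : IsOpen U)
    {z : ℂ} (hz : z ∈ U) (hw : 0 < (Y z).2) :
    pdx (pdx Y) z + pdy (pdy Y) z =
      (2 * (pdx Y z).2 / (Y z).2) • pdx Y z + (2 * (pdy Y z).2 / (Y z).2) • pdy Y z
      - ((0 : ℂ), 2 * flatInner (pdx Y z) (pdx Y z) / (Y z).2)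
      + (2 / (Y z).2) • cross (pdx Y z) (pdy Y z) := by
  have hsm : ContDiffAt ℝ ∞ Y z := hY.smooth.contDiffAt (hU.mem_nhds hz)
  have hdx : DifferentiableAt ℝ (pdx Y) z :=
    ((contDiffOn_pdx hU hY.smooth).contDiffAt (hU.mem_nhds hz)).differentiableAt (by simp)
  have hdy : DifferentiableAt ℝ (pdy Y) z :=
    ((contDiffOn_pdy hU hY.smooth).contDiffAt (hU.mem_nhds hz)).differentiableAt (by simp)
  have hsymm : pdy (pdx Y) z = pdx (pdy Y) z := pdy_pdx_comm (hsm.of_le (by norm_cast))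
  -- Division by zero gives `0`, so a point of height zero would have `coeffE = 0`, against the
  -- immersion hypothesis.
  have hw0 : ∀ v ∈ U, (Y v).2 ^ 2 ≠ 0 := by
    intro v hv h0
    have := hY.immersion v hv
    rw [coeffE, hypInner_eq, h0] at this
    simp at this
  have hEG : ∀ v ∈ U, flatInner (pdx Y v) (pdx Y v) = flatInner (pdy Y v) (pdy Y v) := by
    intro v hv
    have := (hY.conformal v hv).1
    rw [coeffE, coeffG, hypInner_eq, hypInner_eq] at this
    exact (div_left_inj' (hw0 v hv)).1 this
  have hF : ∀ v ∈ U, flatInner (pdx Y v) (pdy Y v) = 0 := by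
    intro v hv
    have := (hY.conformal v hv).2
    rw [coeffF, hypInner_eq, div_eq_zero_iff] at this
    exact this.resolve_right (hw0 v hv)
  have hEG' : (fun v => flatInner (pdx Y v) (pdx Y v)) =ᶠ[𝓝 z]
      fun v => flatInner (pdy Y v) (pdy Y v) := by
    filter_upwards [hU.mem_nhds hz] with v hv using hEG v hv
  have hF' : (fun v => flatInner (pdx Y v) (pdy Y v)) =ᶠ[𝓝 z] fun v => 0 := by
    filter_upwards [hU.mem_nhds hz] with v hv using hF v hv
  -- Differentiating the conformality relations along both axes controls the tangential part of the
  -- flat Laplacian.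
  have e1 (v : ℂ) := DFunLike.congr_fun (hEG'.fderiv_eq (𝕜 := ℝ)) v
  have e2 (v : ℂ) := DFunLike.congr_fun (hF'.fderiv_eq (𝕜 := ℝ)) v
  simp only [fderiv_flatInner hdx hdx, fderiv_flatInner hdy hdy, fderiv_flatInner hdx hdy] at e1 e2
  have e1x : 2 * flatInner (pdx (pdx Y) z) (pdx Y z) = 2 * flatInner (pdx (pdy Y) z) (pdy Y z) := by
    have := e1 1
    simp only [flatInner, pdx, pdy] at this ⊢
    linear_combination this
  have e1y : 2 * flatInner (pdy (pdx Y) z) (pdx Y z) = 2 * flatInner (pdy (pdy Y) z) (pdy Y z) := by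
    have := e1 I
    simp only [flatInner, pdx, pdy] at this ⊢
    linear_combination this
  have e2x : flatInner (pdx (pdx Y) z) (pdy Y z) + flatInner (pdx Y z) (pdx (pdy Y) z) = 0 := by
    have := e2 1
    rw [fderiv_const_apply] at this
    exact this
  have e2y : flatInner (pdy (pdx Y) z) (pdy Y z) + flatInner (pdx Y z) (pdy (pdy Y) z) = 0 := by
    have := e2 I
    rw [fderiv_const_apply] at this
    exact this
  rw [hsymm] at e1y e2y
  have hH := hY.mean_one z hz
  have hE := hY.immersion z hz
  rw [meanCurvature, ← (hY.conformal z hz).1, (hY.conformal z hz).2] at hH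
  have hEne := hE.ne'
  -- For a conformal metric, `H = 1` reads `L + N = 2E`: this is the normal part of the Laplacian.
  have hLN : coeffL Y z + coeffN Y z = 2 * coeffE Y z := by
    rw [div_eq_iff (by ring_nf; positivity)] at hH
    refine mul_left_cancel₀ hEne ?_
    linear_combination hH
  have hq : 0 < flatInner (pdx Y z) (pdx Y z) := by
    rw [coeffE, hypInner_eq] at hE
    by_contra hcon
    exact absurd hE (not_lt.2 (div_nonpos_of_nonpos_of_nonneg (not_lt.1 hcon) (sq_nonneg _)))
  have hqb := (hEG z hz).symm
  have hab := hF z hz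
  have hcc : flatInner (cross (pdx Y z) (pdy Y z)) (cross (pdx Y z) (pdy Y z)) =
      flatInner (pdx Y z) (pdx Y z) ^ 2 := by
    have hl : flatInner (cross (pdx Y z) (pdy Y z)) (cross (pdx Y z) (pdy Y z)) =
      flatInner (pdx Y z) (pdx Y z) * flatInner (pdy Y z) (pdy Y z)
        - flatInner (pdx Y z) (pdy Y z) ^ 2 := by
      simp [flatInner, cross]; ring
    rw [hl, hqb, hab]; ring
  have hsq : Real.sqrt (hypInner (Y z) (cross (pdx Y z) (pdy Y z)) (cross (pdx Y z) (pdy Y z))) =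
      flatInner (pdx Y z) (pdx Y z) / (Y z).2 := by
    rw [hypInner_eq, hcc, ← div_pow, Real.sqrt_sq (by positivity)]
  rw [coeffL, coeffN, coeffE, unitNormal, hsq] at hLN
  generalize pdx Y z = a at *
  generalize pdy Y z = b at *
  generalize pdx (pdx Y) z = X1 at *
  generalize pdy (pdy Y) z = X2 at *
  generalize pdx (pdy Y) z = X3 at *
  generalize Y z = p at *
  clear e1 e2 hEG' hF' hEG hF hw0 hsm hdx hdy hsymm hH hY hE hEne
  -- The claim is `∇ₓYₓ + ∇ᵧYᵧ = 2E·(unit normal)` with the Christoffel terms written out. The two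
  -- tangential components come from conformality and the normal one from the mean curvature.
  have hV := eq_of_flatInner (V := X1 + X2 - (2 * a.2 / p.2) • a - (2 * b.2 / p.2) • b
    + ((0 : ℂ), 2 * flatInner a a / p.2)) (a := a) (b := b) hq hab hqb ?_ ?_ (2 / p.2) ?_
  · rw [← hV]; abel
  · have : flatInner (X1 + X2 - (2 * a.2 / p.2) • a - (2 * b.2 / p.2) • b
      + ((0 : ℂ), 2 * flatInner a a / p.2)) a = flatInner X1 a + flatInner X2 a
        - (2 * b.2 / p.2) * flatInner a b := by
      simp [flatInner]; ring
    rw [this, hab]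
    have e3 : flatInner X3 b + flatInner X2 a = 0 := by
      simp only [flatInner] at e2y ⊢; linear_combination e2y
    linear_combination e1x / 2 + e3
  · have : flatInner (X1 + X2 - (2 * a.2 / p.2) • a - (2 * b.2 / p.2) • b
      + ((0 : ℂ), 2 * flatInner a a / p.2)) b = flatInner X1 b + flatInner X2 b
        - (2 * a.2 / p.2) * flatInner a b - (2 * b.2 / p.2) * (flatInner b b - flatInner a a) := by
      simp [flatInner]; ring
    rw [this, hab, hqb]
    have e3 : flatInner X1 b + flatInner X3 a = 0 := by
      simp only [flatInner] at e2x ⊢; linear_combination e2x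
    linear_combination e3 - e1y / 2
  · have hp := hw.ne'
    have hq' := hq.ne'
    -- Writing the vertical correction as `(|a|² + |b|²)/w` lets the vector split into the two
    -- covariant derivatives that occur in `L` and `N`.
    have e4 : flatInner a a * 2 * flatInner a a / p.2 = flatInner (X1 + X2 - (2 * a.2 / p.2) • a
      - (2 * b.2 / p.2) • b + ((0 : ℂ), (flatInner a a + flatInner b b) / p.2)) (cross a b) := by
      rw [hypInner_eq, hypInner_eq, hypInner_eq, covDeriv, covDeriv, hypInner_eq, hypInner_eq] at hLN
      have e5 : ∀ V c : ℂ × ℝ, ∀ s : ℝ, flatInner V (s • c) = s * flatInner V c := by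
        intro V c s; simp [flatInner]; ring
      rw [e5, e5] at hLN
      have e6 : flatInner (X1 + X2 - (2 * a.2 / p.2) • a
        - (2 * b.2 / p.2) • b + ((0 : ℂ), (flatInner a a + flatInner b b) / p.2)) (cross a b) =
        flatInner (X1 - (a.2 / p.2) • a - (a.2 / p.2) • a + (0, p.2 * (flatInner a a / p.2 ^ 2))) (cross a b) +
        flatInner (X2 - (b.2 / p.2) • b - (b.2 / p.2) • b + (0, p.2 * (flatInner b b / p.2 ^ 2))) (cross a b) := by
        have : p.2 * (flatInner a a / p.2 ^ 2) = flatInner a a / p.2 := by field_simp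
        have : p.2 * (flatInner b b / p.2 ^ 2) = flatInner b b / p.2 := by field_simp
        simp only [*]
        generalize flatInner b b / p.2 = k1
        simp [flatInner]
        ring
      rw [e6]
      generalize flatInner (X1 - (a.2 / p.2) • a - (a.2 / p.2) • a + (0, p.2 * (flatInner a a / p.2 ^ 2))) (cross a b) = m1 at *
      generalize flatInner (X2 - (b.2 / p.2) • b - (b.2 / p.2) • b + (0, p.2 * (flatInner b b / p.2 ^ 2))) (cross a b) = m2 at *
      field_simp at hLN ⊢
      linear_combination -hLN
    rw [hqb, ← two_mul] at e4
    rw [← e4]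
    ring

end

/-! ### The flux form and Bryant's holomorphy theorem. -/

section

open Complex

lemma wirt_holomorphic_comp {g f : ℂ → ℂ} {g' z : ℂ} (hg : HasDerivAt g g' (f z))
    (hf : DifferentiableAt ℝ f z) : wirt (fun v => g (f v)) z = g' * wirt f z := by
  have h := ((hg.hasFDerivAt.restrictScalars ℝ).comp z hf.hasFDerivAt).fderiv
  change fderiv ℝ (fun v => g (f v)) z = _ at h
  rw [wirt, wirt, h]
  simp
  ring

lemma wirtBar_holomorphic_comp {g f : ℂ → ℂ} {g' z : ℂ} (hg : HasDerivAt g g' (f z))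
    (hf : DifferentiableAt ℝ f z) : wirtBar (fun v => g (f v)) z = g' * wirtBar f z := by
  have h := ((hg.hasFDerivAt.restrictScalars ℝ).comp z hf.hasFDerivAt).fderiv
  change fderiv ℝ (fun v => g (f v)) z = _ at h
  rw [wirtBar, wirtBar, h]
  simp
  ring

lemma wirt_inv {f : ℂ → ℂ} {z : ℂ} (hf : DifferentiableAt ℝ f z) (h0 : f z ≠ 0) :
    wirt (fun v => (f v)⁻¹) z = -(f z ^ 2)⁻¹ * wirt f z :=
  wirt_holomorphic_comp (hasDerivAt_inv h0) hf

lemma wirtBar_inv {f : ℂ → ℂ} {z : ℂ} (hf : DifferentiableAt ℝ f z) (h0 : f z ≠ 0) :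
    wirtBar (fun v => (f v)⁻¹) z = -(f z ^ 2)⁻¹ * wirtBar f z :=
  wirtBar_holomorphic_comp (hasDerivAt_inv h0) hf

/-- The matrix-valued form `∂N · N⁻¹`, where `N` is the expression of `Y` in the Minkowski model. -/
def fluxForm (Y : ℂ → ℂ × ℝ) (z : ℂ) : Matrix (Fin 2) (Fin 2) ℂ :=
  Matrix.of (fun i j => wirt (fun v => toHermitian (Y v) i j) z) * (toHermitian (Y z)).adjugate

lemma fluxForm_congr {Y Y' : ℂ → ℂ × ℝ} {z : ℂ} (h : Y =ᶠ[𝓝 z] Y') :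
    fluxForm Y z = fluxForm Y' z := by
  rw [fluxForm, fluxForm, h.eq_of_nhds]
  congr 2
  ext i j
  exact wirt_congr (h.fun_comp fun p => toHermitian p i j)

lemma differentiableAt_toHermitian {p : ℂ × ℝ} (hp : p.2 ≠ 0) (i j : Fin 2) :
    DifferentiableAt ℝ (fun q : ℂ × ℝ => toHermitian q i j) p := by
  have hp' : (p.2 : ℂ) ≠ 0 := by exact_mod_cast hp
  have h2 : DifferentiableAt ℝ (fun q : ℂ × ℝ => (q.2 : ℂ)) p :=
    (ofRealCLM.differentiableAt).comp p differentiableAt_snd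
  have h1 : DifferentiableAt ℝ (fun q : ℂ × ℝ => starRingEnd ℂ q.1) p :=
    (conjCLE.differentiableAt).comp p differentiableAt_fst
  fin_cases i <;> fin_cases j <;> simp only [toHermitian, Fin.zero_eta, Fin.mk_one, Fin.isValue,
    Matrix.of_apply, Matrix.cons_val', Matrix.cons_val_zero, Matrix.cons_val_fin_one,
    Matrix.cons_val_one, div_eq_mul_inv]
  · exact (h2.inv hp').const_mul _
  · exact h1.mul (h2.inv hp')
  · exact differentiableAt_fst.mul (h2.inv hp')
  · exact h2.add ((differentiableAt_fst.mul h1).mul (h2.inv hp'))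

/-- The flux form is the coefficient of a (1,0)-form, hence the single factor `τ'`. -/
lemma fluxForm_comp {Y : ℂ → ℂ × ℝ} {τ : ℂ → ℂ} {τ' z : ℂ} (hY : DifferentiableAt ℝ Y (τ z))
    (hw : (Y (τ z)).2 ≠ 0) (hτ : HasDerivAt τ τ' z) :
    fluxForm (fun v => Y (τ v)) z = τ' • fluxForm Y (τ z) := by
  rw [fluxForm, fluxForm, ← Matrix.smul_mul]
  congr 1
  ext i j
  exact wirt_comp ((differentiableAt_toHermitian hw i j).comp _ hY) hτ

lemma adjugate_toHermitian (p : ℂ × ℝ) : (toHermitian p).adjugate =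
    !![p.2 + p.1 * starRingEnd ℂ p.1 / p.2, -(starRingEnd ℂ p.1 / p.2);
      -(p.1 / p.2), 1 / (p.2 : ℂ)] := by
  rw [Matrix.adjugate_fin_two]
  simp [toHermitian]

section entries

variable {Y : ℂ → ℂ × ℝ} {z : ℂ}

lemma differentiableAt_wcoord (hY : DifferentiableAt ℝ Y z) :
    DifferentiableAt ℝ (fun v => ((Y v).2 : ℂ)) z :=
  (ofRealCLM.differentiableAt).comp z hY.snd

lemma differentiableAt_conj {f : ℂ → ℂ} (hf : DifferentiableAt ℝ f z) :
    DifferentiableAt ℝ (fun v => starRingEnd ℂ (f v)) z :=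
  (conjCLE.differentiableAt).comp z hf

/-- The matrix is traceless because `det N = 1`, so three functions describe it. They are
triangular: `b` involves only `∂ζ̄` and `w`, then `g` uses `b`, and the lower left entry uses both.
Their holomorphy can be checked in that order. -/
lemma fluxForm_apply (hY : DifferentiableAt ℝ Y z) (hw : (Y z).2 ≠ 0) :
    let b := wirt (fun v => starRingEnd ℂ (Y v).1) z / (Y z).2 ^ 2
    let g := wirt (fun v => ((Y v).2 : ℂ)) z / (Y z).2 + (Y z).1 * b
    fluxForm Y z = !![-g, b; wirt (fun v => (Y v).1) z - 2 * (Y z).1 * g + (Y z).1 ^ 2 * b, g] := by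
  intro b g
  have hw' : ((Y z).2 : ℂ) ≠ 0 := by exact_mod_cast hw
  have hW := differentiableAt_wcoord hY
  have hWi : DifferentiableAt ℝ (fun v => ((Y v).2 : ℂ)⁻¹) z := hW.inv hw'
  have hp : DifferentiableAt ℝ (fun v => (Y v).1) z := hY.fst
  have hc := differentiableAt_conj hp
  have e := wirt_inv hW hw'
  have e01 := wirt_mul hc hWi
  have e10 := wirt_mul hp hWi
  have e11 := wirt_mul hp hc
  have hpc : DifferentiableAt ℝ (fun v => (Y v).1 * starRingEnd ℂ (Y v).1) z := hp.mul hc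
  have hpcw : DifferentiableAt ℝ
    (fun v => (Y v).1 * starRingEnd ℂ (Y v).1 * ((Y v).2 : ℂ)⁻¹) z := hpc.mul hWi
  have e11' := wirt_add hW hpcw
  have e11'' := wirt_mul hpc hWi
  have hM : Matrix.of (fun i j => wirt (fun v => toHermitian (Y v) i j) z) =
      !![wirt (fun v => ((Y v).2 : ℂ)⁻¹) z, wirt (fun v => starRingEnd ℂ (Y v).1 * ((Y v).2 : ℂ)⁻¹) z;
        wirt (fun v => (Y v).1 * ((Y v).2 : ℂ)⁻¹) z,
        wirt (fun v => (Y v).2 + (Y v).1 * starRingEnd ℂ (Y v).1 * ((Y v).2 : ℂ)⁻¹) z] := by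
    ext i j
    fin_cases i <;> fin_cases j <;> simp [toHermitian, div_eq_mul_inv]
  rw [fluxForm, hM, adjugate_toHermitian, e, e01, e10]
  rw [e11', e11'', e11, e]
  simp only [b, g]
  generalize wirt (fun v => starRingEnd ℂ (Y v).1) z = pc
  generalize wirt (fun v => (Y v).1) z = pz
  generalize wirt (fun v => ((Y v).2 : ℂ)) z = wz
  generalize starRingEnd ℂ (Y z).1 = q
  ext i j
  fin_cases i <;> fin_cases j <;> simp [Matrix.mul_apply, Fin.sum_univ_two] <;> field_simp <;> ring

end entries

lemma fderiv_clm_comp {F G : Type*} [NormedAddCommGroup F] [NormedSpace ℝ F] [NormedAddCommGroup G]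
    [NormedSpace ℝ G] (c : F →L[ℝ] G) {Y : ℂ → F} {z : ℂ} (hY : DifferentiableAt ℝ Y z) (v : ℂ) :
    fderiv ℝ (fun u => c (Y u)) z v = c (fderiv ℝ Y z v) := by
  have := (c.hasFDerivAt.comp z hY.hasFDerivAt).fderiv
  change fderiv ℝ (fun u => c (Y u)) z = _ at this
  rw [this]; rfl

section holomorphic

variable {Y : ℂ → ℂ × ℝ} {U : Set ℂ}

lemma wirt_clm_comp (c : ℂ × ℝ →L[ℝ] ℂ) {z : ℂ} (hY : DifferentiableAt ℝ Y z) :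
    wirt (fun v => c (Y v)) z = (c (pdx Y z) - I * c (pdy Y z)) / 2 := by
  rw [wirt, fderiv_clm_comp c hY, fderiv_clm_comp c hY]; rfl

lemma wirtBar_clm_comp (c : ℂ × ℝ →L[ℝ] ℂ) {z : ℂ} (hY : DifferentiableAt ℝ Y z) :
    wirtBar (fun v => c (Y v)) z = (c (pdx Y z) + I * c (pdy Y z)) / 2 := by
  rw [wirtBar, fderiv_clm_comp c hY, fderiv_clm_comp c hY]; rfl

lemma differentiableAt_of_smooth {F : Type*} [NormedAddCommGroup F] [NormedSpace ℝ F]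
    {Y : ℂ → F} (hU : IsOpen U) (hY : ContDiffOn ℝ ∞ Y U) {z : ℂ}
    (hz : z ∈ U) : DifferentiableAt ℝ Y z :=
  (hY.contDiffAt (hU.mem_nhds hz)).differentiableAt (by simp)

lemma wirt_clm_comp_differentiableAt (hU : IsOpen U) (hY : ContDiffOn ℝ ∞ Y U)
    (c : ℂ × ℝ →L[ℝ] ℂ) {z : ℂ} (hz : z ∈ U) :
    DifferentiableAt ℝ (wirt (fun v => c (Y v))) z := by
  have h : wirt (fun v => c (Y v)) =ᶠ[𝓝 z] fun v => (c (pdx Y v) - I * c (pdy Y v)) / 2 := by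
    filter_upwards [hU.mem_nhds hz] with v hv
    exact wirt_clm_comp c (differentiableAt_of_smooth hU hY hv)
  have h1 := differentiableAt_of_smooth hU (contDiffOn_pdx hU hY) hz
  have h2 := differentiableAt_of_smooth hU (contDiffOn_pdy hU hY) hz
  refine DifferentiableAt.congr_of_eventuallyEq ?_ h
  fun_prop

/-- This is `4 ∂̄∂ = Δ`, applied to a coordinate of `Y` so that the mean curvature equation can be
inserted. -/
lemma wirtBar_wirt_clm_comp (hU : IsOpen U) (hY : ContDiffOn ℝ ∞ Y U)
    (c : ℂ × ℝ →L[ℝ] ℂ) {z : ℂ} (hz : z ∈ U) :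
    wirtBar (wirt (fun v => c (Y v))) z = c (pdx (pdx Y) z + pdy (pdy Y) z) / 4 := by
  have h : wirt (fun v => c (Y v)) =ᶠ[𝓝 z] fun v => c (pdx Y v) * (1 / 2) + (-I / 2) * c (pdy Y v) := by
    filter_upwards [hU.mem_nhds hz] with v hv
    rw [wirt_clm_comp c (differentiableAt_of_smooth hU hY hv)]
    ring
  have h1 := differentiableAt_of_smooth hU (contDiffOn_pdx hU hY) hz
  have h2 := differentiableAt_of_smooth hU (contDiffOn_pdy hU hY) hz
  have h3 : pdy (pdx Y) z = pdx (pdy Y) z :=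
    pdy_pdx_comm ((hY.contDiffAt (hU.mem_nhds hz)).of_le (by norm_cast))
  rw [wirtBar_congr h, wirtBar_add (by fun_prop) (by fun_prop), wirtBar_mul (by fun_prop) (by fun_prop),
    wirtBar_mul (by fun_prop) (by fun_prop), wirtBar_const, wirtBar_const, wirtBar_clm_comp c h1,
    wirtBar_clm_comp c h2, h3, map_add]
  linear_combination (-c (pdy (pdy Y) z) / 4) * I_sq

/-- Bryant's theorem: `∂N · N⁻¹` is holomorphic on a surface of mean curvature one. -/
lemma IsBryantPatch.differentiableOn_fluxForm (hY : IsBryantPatch Y U) (hU : IsOpen U)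
    (hw : ∀ z ∈ U, 0 < (Y z).2) (i j : Fin 2) :
    DifferentiableOn ℂ (fun z => fluxForm Y z i j) U := by
  let cp : ℂ × ℝ →L[ℝ] ℂ := ContinuousLinearMap.fst ℝ ℂ ℝ
  let cq : ℂ × ℝ →L[ℝ] ℂ := (conjCLE : ℂ →L[ℝ] ℂ) ∘L ContinuousLinearMap.fst ℝ ℂ ℝ
  let cw : ℂ × ℝ →L[ℝ] ℂ := ofRealCLM ∘L ContinuousLinearMap.snd ℝ ℂ ℝ
  intro z hz
  refine DifferentiableAt.differentiableWithinAt ?_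
  set b : ℂ → ℂ := fun v => wirt (fun u => cq (Y u)) v * (cw (Y v) * cw (Y v))⁻¹ with hb
  set g : ℂ → ℂ := fun v => wirt (fun u => cw (Y u)) v * (cw (Y v))⁻¹ + cp (Y v) * b v with hg
  set d : ℂ → ℂ := fun v => wirt (fun u => cp (Y u)) v + ((-2) * (cp (Y v) * g v) +
    cp (Y v) * (cp (Y v) * b v)) with hd
  have hwz := hw z hz
  have hwz' : cw (Y z) ≠ 0 := by simpa [cw] using hwz.ne'
  have hsm := hY.smooth
  have hYd := differentiableAt_of_smooth hU hsm hz
  have dP : DifferentiableAt ℝ (fun v => cp (Y v)) z := by fun_prop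
  have dW : DifferentiableAt ℝ (fun v => cw (Y v)) z := by fun_prop
  have dWi : DifferentiableAt ℝ (fun v => (cw (Y v))⁻¹) z := dW.inv hwz'
  have dWW : DifferentiableAt ℝ (fun v => cw (Y v) * cw (Y v)) z := dW.mul dW
  have dWWi : DifferentiableAt ℝ (fun v => (cw (Y v) * cw (Y v))⁻¹) z :=
    dWW.inv (mul_ne_zero hwz' hwz')
  have dPz := wirt_clm_comp_differentiableAt hU hsm cp hz
  have dQz := wirt_clm_comp_differentiableAt hU hsm cq hz
  have dWz := wirt_clm_comp_differentiableAt hU hsm cw hz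
  have db : DifferentiableAt ℝ b z := dQz.mul dWWi
  have dPb : DifferentiableAt ℝ (fun v => cp (Y v) * b v) z := dP.mul db
  have dg1 : DifferentiableAt ℝ (fun v => wirt (fun u => cw (Y u)) v * (cw (Y v))⁻¹) z := dWz.mul dWi
  have dg : DifferentiableAt ℝ g z := dg1.add dPb
  have dPg : DifferentiableAt ℝ (fun v => cp (Y v) * g v) z := dP.mul dg
  have d1 : DifferentiableAt ℝ (fun v => (-2) * (cp (Y v) * g v)) z := dPg.const_mul _
  have d2 : DifferentiableAt ℝ (fun v => cp (Y v) * (cp (Y v) * b v)) z := dP.mul dPb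
  have d12 : DifferentiableAt ℝ
    (fun v => (-2) * (cp (Y v) * g v) + cp (Y v) * (cp (Y v) * b v)) z := d1.add d2
  have dd : DifferentiableAt ℝ d z := dPz.add d12
  have hL := hY.laplacian hU hz hwz
  have kP := wirtBar_wirt_clm_comp hU hsm cp hz
  have kQ := wirtBar_wirt_clm_comp hU hsm cq hz
  have kW := wirtBar_wirt_clm_comp hU hsm cw hz
  have aP := wirt_clm_comp cp hYd
  have aQ := wirt_clm_comp cq hYd
  have aW := wirt_clm_comp cw hYd
  have bP := wirtBar_clm_comp cp hYd
  have bQ := wirtBar_clm_comp cq hYd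
  have bW := wirtBar_clm_comp cw hYd
  have hEG : flatInner (pdx Y z) (pdx Y z) = flatInner (pdy Y z) (pdy Y z) := by
    have := (hY.conformal z hz).1
    rw [coeffE, coeffG, hypInner_eq, hypInner_eq] at this
    exact (div_left_inj' (by positivity)).1 this
  -- The mean curvature equation in complex form: `∂̄∂ζ = 2 ∂w ∂̄ζ / w`, then its analogues for `ζ̄`
  -- and `w`. The cross product term, whose sign is fixed by the orientation, decides which of `∂w
  -- ∂̄ζ` and `∂̄w ∂ζ` survives.
  have kP' : wirtBar (wirt (fun v => cp (Y v))) z =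
      2 * wirt (fun v => cw (Y v)) z * wirtBar (fun v => cp (Y v)) z / cw (Y z) := by
    rw [kP, hL, aW, bP]
    have := hwz.ne'
    simp only [cp, cw, cross]
    apply Complex.ext <;> simp <;> field_simp <;> ring
  have kQ' : wirtBar (wirt (fun v => cq (Y v))) z =
      2 * wirtBar (fun v => cw (Y v)) z * wirt (fun v => cq (Y v)) z / cw (Y z) := by
    rw [kQ, hL, bW, aQ]
    have := hwz.ne'
    simp only [cq, cw, cross]
    apply Complex.ext <;> simp <;> field_simp <;> ring
  have kW' : wirtBar (wirt (fun v => cw (Y v))) z =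
      (wirt (fun v => cw (Y v)) z * wirtBar (fun v => cw (Y v)) z
        - wirtBar (fun v => cp (Y v)) z * wirt (fun v => cq (Y v)) z) / cw (Y z) := by
    rw [kW, hL, aW, bW, bP, aQ]
    have := hwz.ne'
    have hE2 : 2 * flatInner (pdx Y z) (pdx Y z) =
      flatInner (pdx Y z) (pdx Y z) + flatInner (pdy Y z) (pdy Y z) := by rw [← hEG]; ring
    rw [hE2]
    simp only [cp, cq, cw, cross, flatInner]
    apply Complex.ext <;> simp <;> field_simp <;> ring
  -- Since `b = ∂ζ̄ / w²`, the equation for `ζ̄` is exactly `∂̄b = 0`. The equations for `w` and `ζ`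
  -- then give `∂̄g = 0` and `∂̄d = 0`.
  have zb : wirtBar b z = 0 := by
    rw [hb, wirtBar_mul dQz dWWi, wirtBar_inv dWW (mul_ne_zero hwz' hwz'),
      wirtBar_mul dW dW, kQ']
    field_simp
    ring
  have qz : wirt (fun v => cq (Y v)) z = b z * (cw (Y z) * cw (Y z)) := by
    simp only [hb]; field_simp
  have zg : wirtBar g z = 0 := by
    rw [hg, wirtBar_add dg1 dPb, wirtBar_mul dWz dWi, wirtBar_inv dW hwz', wirtBar_mul dP db, kW', zb,
      qz]
    field_simp
    ring
  have zd : wirtBar d z = 0 := by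
    have hgz : wirt (fun v => cw (Y v)) z = (g z - cp (Y z) * b z) * cw (Y z) := by
      simp only [hg]; field_simp; ring
    rw [hd, wirtBar_add dPz d12, wirtBar_add d1 d2, wirtBar_mul (by fun_prop) dPg,
      wirtBar_const, wirtBar_mul dP dg, wirtBar_mul dP dPb, wirtBar_mul dP db, zb, zg, kP', hgz]
    field_simp
    ring
  have hflux : (fun v => fluxForm Y v i j) =ᶠ[𝓝 z]
      fun v => (!![-g v, b v; d v, g v] : Matrix (Fin 2) (Fin 2) ℂ) i j := by
    filter_upwards [hU.mem_nhds hz] with v hv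
    rw [fluxForm_apply (differentiableAt_of_smooth hU hsm hv) (hw v hv).ne']
    simp only [hb, hg, hd, cp, cq, cw]
    fin_cases i <;> fin_cases j <;> simp <;> ring
  refine DifferentiableAt.congr_of_eventuallyEq ?_ hflux
  have hb' := differentiableAt_of_wirtBar_eq_zero db zb
  have hg' := differentiableAt_of_wirtBar_eq_zero dg zg
  have hd' := differentiableAt_of_wirtBar_eq_zero dd zd
  fin_cases i <;> fin_cases j
  exacts [hg'.neg, hb', hd', hg']

end holomorphic

end

/-! ### Residues as integrals against the `∂̄` of a cutoff. -/

section

open MeasureTheory Complex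

lemma isOpen_puncturedDisc (r : ℝ) : IsOpen (puncturedDisc r) :=
  Metric.isOpen_ball.sdiff isClosed_singleton

lemma mem_puncturedDisc {r : ℝ} {z : ℂ} : z ∈ puncturedDisc r ↔ ‖z‖ < r ∧ z ≠ 0 := by
  simp [puncturedDisc]

/-- A smooth radial cutoff, as a function of the square of the modulus. -/
def cutoff (s t x : ℝ) : ℝ := Real.smoothTransition ((x - s) / (t - s))

section cutoff

variable {s t : ℝ}

lemma contDiff_cutoff (s t : ℝ) : ContDiff ℝ ∞ (cutoff s t) :=
  Real.smoothTransition.contDiff.comp ((contDiff_id.sub contDiff_const).div_const _)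

lemma cutoff_of_le (h : s < t) {x : ℝ} (hx : x ≤ s) : cutoff s t x = 0 :=
  Real.smoothTransition.zero_of_nonpos
    (div_nonpos_of_nonpos_of_nonneg (by linarith) (by linarith))

lemma cutoff_of_ge (h : s < t) {x : ℝ} (hx : t ≤ x) : cutoff s t x = 1 :=
  Real.smoothTransition.one_of_one_le ((one_le_div (by linarith)).2 (by linarith))

lemma continuous_deriv_cutoff (s t : ℝ) : Continuous (deriv (cutoff s t)) :=
  (contDiff_cutoff s t).continuous_deriv (by simp)

lemma deriv_cutoff_of_lt (h : s < t) {x : ℝ} (hx : x < s ∨ t < x) : deriv (cutoff s t) x = 0 := by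
  rcases hx with hx | hx
  · have : cutoff s t =ᶠ[𝓝 x] fun _ => 0 := by
      filter_upwards [Iio_mem_nhds hx] with y hy using cutoff_of_le h (le_of_lt hy)
    rw [this.deriv_eq]; simp
  · have : cutoff s t =ᶠ[𝓝 x] fun _ => 1 := by
      filter_upwards [Ioi_mem_nhds hx] with y hy using cutoff_of_ge h (le_of_lt hy)
    rw [this.deriv_eq]; simp

lemma hasDerivAt_cutoff (s t x : ℝ) : HasDerivAt (cutoff s t) (deriv (cutoff s t) x) x :=
  ((contDiff_cutoff s t).differentiable (by simp) x).hasDerivAt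

lemma integral_deriv_cutoff_sq (hs : 0 < s) (h : s < t) :
    ∫ y in Set.Ioi (0 : ℝ), y * deriv (cutoff s t) (y ^ 2) = 1 / 2 := by
  have hd : ∀ y, HasDerivAt (fun y => cutoff s t (y ^ 2) - 1) (2 * (y * deriv (cutoff s t) (y ^ 2))) y := by
    intro y
    have := ((hasDerivAt_cutoff s t (y ^ 2)).comp y (hasDerivAt_pow 2 y)).sub_const 1
    refine HasDerivAt.congr_deriv this ?_
    rw [Nat.cast_ofNat]
    ring
  -- The cutoff tends to `1` at infinity; subtracting `1` gives it compact support without changing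
  -- its derivative.
  have hc : HasCompactSupport (fun y => cutoff s t (y ^ 2) - 1) := by
    refine HasCompactSupport.intro (isCompact_Icc (a := -(t + 1)) (b := t + 1)) fun x hx => ?_
    rw [cutoff_of_ge h, sub_self]
    by_contra hcon
    exact hx ⟨by nlinarith, by nlinarith⟩
  have hcd : ContDiff ℝ 1 (fun y => cutoff s t (y ^ 2) - 1) :=
    (((contDiff_cutoff s t).comp (contDiff_id.pow 2)).sub contDiff_const).of_le (by norm_cast)
  have := hc.integral_Ioi_deriv_eq hcd 0
  simp only [fun y => (hd y).deriv, integral_const_mul] at this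
  rw [cutoff_of_le h (by simpa using hs.le)] at this
  linarith

/-- In polar coordinates the integral is `2π ∫ y κ(y²) dy`, with `κ` the derivative of the cutoff,
and the radial integral is `1/2`. -/
lemma integral_deriv_cutoff_normSq (hs : 0 < s) (h : s < t) :
    ∫ z : ℂ, ((deriv (cutoff s t) (normSq z) : ℝ) : ℂ) = Real.pi := by
  have h1 : ∫ z : ℂ, deriv (cutoff s t) (normSq z) = Real.pi := by
    have := integral_fun_norm_addHaar (volume : Measure ℂ) (fun y => deriv (cutoff s t) (y ^ 2))
    simp only [normSq_eq_norm_sq]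
    rw [this]
    simp only [Complex.finrank_real_complex, smul_eq_mul, Nat.add_one_sub_one, pow_one]
    rw [integral_deriv_cutoff_sq hs h, Measure.real, Complex.volume_ball]
    simp
    ring
  rw [← h1]
  exact integral_ofReal

/-- The factor `z` is `∂̄|z|²`; working with `|z|²` instead of `|z|` keeps everything smooth at `0`.
-/
lemma wirtBar_cutoff (s t : ℝ) (z : ℂ) :
    wirtBar (fun v => ((cutoff s t (normSq v) : ℝ) : ℂ)) z = deriv (cutoff s t) (normSq z) * z := by
  have h1 : HasFDerivAt (fun v : ℂ => normSq v) ((2 * z.re) • reCLM + (2 * z.im) • imCLM) z := by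
    have := ((reCLM.hasFDerivAt (x := z)).mul reCLM.hasFDerivAt).add
      ((imCLM.hasFDerivAt (x := z)).mul imCLM.hasFDerivAt)
    refine this.congr_fderiv ?_
    ext v
    all_goals simp
    all_goals ring
  have h2 : HasFDerivAt (fun v : ℂ => ((cutoff s t (normSq v) : ℝ) : ℂ)) _ z :=
    ofRealCLM.hasFDerivAt.comp z ((hasDerivAt_cutoff s t (normSq z)).hasFDerivAt.comp z h1)
  rw [wirtBar, h2.fderiv]
  simp
  generalize deriv (cutoff s t) (normSq z) = k
  conv_rhs => rw [← re_add_im z]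
  ring

lemma contDiff_cutoff_normSq (s t : ℝ) : ContDiff ℝ ∞ (fun z : ℂ => cutoff s t (normSq z)) := by
  have : ContDiff ℝ ∞ (fun z : ℂ => normSq z) := by
    simp only [normSq_apply]
    have h1 : ContDiff ℝ ∞ (fun z : ℂ => z.re) := reCLM.contDiff
    have h2 : ContDiff ℝ ∞ (fun z : ℂ => z.im) := imCLM.contDiff
    exact (h1.mul h1).add (h2.mul h2)
  exact (contDiff_cutoff s t).comp this

end cutoff

lemma contDiffOn_ofReal {g : ℂ → ℝ} {U : Set ℂ} {n : WithTop ℕ∞} (hg : ContDiffOn ℝ n g U) :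
    ContDiffOn ℝ n (fun z => (g z : ℂ)) U :=
  ofRealCLM.contDiff.comp_contDiffOn hg

lemma contDiffOn_real_of_differentiableOn {f : ℂ → ℂ} {U : Set ℂ} (hU : IsOpen U)
    (hf : DifferentiableOn ℂ f U) : ContDiffOn ℝ 1 f U :=
  (hf.contDiffOn hU).restrict_scalars ℝ

/-- The integral of a radial cutoff against `h(z)/z² dz` is the residue, up to a factor `π`. -/
lemma integral_wirtBar_cutoff {r s t : ℝ} (hs : 0 < s) (hst : s < t) (htr : t < r) {h : ℂ → ℂ}
    (hh : DifferentiableOn ℂ h (Metric.ball 0 r)) :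
    ∫ z in puncturedDisc r, wirtBar (fun v => ((cutoff (s ^ 2) (t ^ 2) (normSq v) : ℝ) : ℂ)) z
      * (h z / z ^ 2) = Real.pi * deriv h 0 := by
  have hr : 0 < r := by linarith
  have ht : 0 ≤ t := by linarith
  have hst2 : s ^ 2 < t ^ 2 := by gcongr
  have hs2 : 0 < s ^ 2 := by positivity
  set κ : ℝ → ℝ := deriv (cutoff (s ^ 2) (t ^ 2)) with hκ
  have hκ0 : ∀ z : ℂ, ‖z‖ < s ∨ t < ‖z‖ → κ (normSq z) = 0 := by
    intro z hz
    refine deriv_cutoff_of_lt hst2 ?_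
    rw [normSq_eq_norm_sq]
    rcases hz with hz | hz
    · left; gcongr
    · right; gcongr
  have hκc : Continuous fun z : ℂ => ((κ (normSq z) : ℝ) : ℂ) :=
    continuous_ofReal.comp ((continuous_deriv_cutoff _ _).comp continuous_normSq)
  have hb : Metric.ball (0 : ℂ) r ∈ 𝓝 (0 : ℂ) := Metric.ball_mem_nhds 0 hr
  -- Two divided differences give `h = h(0) + h'(0) z + z² h2` with `h2` holomorphic on the whole
  -- disc. Divided by `z²` and multiplied by `z`, the three terms are treated separately.
  set h1 := dslope h 0 with hh1
  set h2 := dslope h1 0 with hh2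
  have d1 : DifferentiableOn ℂ h1 (Metric.ball 0 r) := (differentiableOn_dslope hb).2 hh
  have d2 : DifferentiableOn ℂ h2 (Metric.ball 0 r) := (differentiableOn_dslope hb).2 d1
  have hexp : ∀ z, h z = h 0 + z * (deriv h 0 + z * h2 z) := by
    intro z
    have e1 := sub_smul_dslope h 0 z
    have e2 := sub_smul_dslope h1 0 z
    have e3 : h1 0 = deriv h 0 := dslope_same h 0
    simp only [sub_zero, smul_eq_mul] at e1 e2
    rw [← e3]
    change z * h1 z = _ at e1
    change z * h2 z = _ at e2
    rw [e2]
    linear_combination -e1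
  set K : Set ℂ := Metric.closedBall 0 t \ Metric.ball 0 s with hK
  have hKc : IsCompact K := (isCompact_closedBall 0 t).diff Metric.isOpen_ball
  have hKU : K ⊆ puncturedDisc r := by
    intro z hz
    simp only [hK, Set.mem_sdiff, Metric.mem_closedBall, dist_zero_right, Metric.mem_ball, not_lt] at hz
    exact mem_puncturedDisc.2 ⟨by linarith, fun h0 => by rw [h0, norm_zero] at hz; linarith⟩
  have hκK : ∀ z, z ∉ K → κ (normSq z) = 0 := by
    intro z hz
    refine hκ0 z ?_
    simp only [hK, Set.mem_sdiff, Metric.mem_closedBall, dist_zero_right, Metric.mem_ball, not_lt,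
      not_and, not_le] at hz
    by_cases h : ‖z‖ ≤ t
    · exact Or.inl (hz h)
    · exact Or.inr (not_le.1 h)
  have hpU := isOpen_puncturedDisc r
  have hsub : puncturedDisc r ⊆ Metric.ball 0 r := Set.sdiff_subset
  have hne : ∀ z ∈ puncturedDisc r, z ≠ 0 := fun z hz => hz.2
  have i0 : IntegrableOn (fun z : ℂ => ((κ (normSq z) : ℝ) : ℂ) * (h 0 / z)) (puncturedDisc r) :=
    integrableOn_of_continuousOn_of_compact hpU hKc hKU
      (hκc.continuousOn.mul (continuousOn_const.div continuousOn_id hne))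
      fun z _ hz => by rw [hκK z hz]; simp
  have i1 : IntegrableOn (fun z : ℂ => ((κ (normSq z) : ℝ) : ℂ) * deriv h 0) (puncturedDisc r) :=
    integrableOn_of_continuousOn_of_compact hpU hKc hKU
      (hκc.continuousOn.mul continuousOn_const) fun z _ hz => by rw [hκK z hz]; simp
  have i2 : IntegrableOn (fun z : ℂ => ((κ (normSq z) : ℝ) : ℂ) * (z * h2 z)) (puncturedDisc r) :=
    integrableOn_of_continuousOn_of_compact hpU hKc hKU
      (hκc.continuousOn.mul (continuousOn_id.mul (d2.continuousOn.mono hsub)))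
      fun z _ hz => by rw [hκK z hz]; simp
  have hsplit : ∀ z ∈ puncturedDisc r,
      wirtBar (fun v => ((cutoff (s ^ 2) (t ^ 2) (normSq v) : ℝ) : ℂ)) z * (h z / z ^ 2) =
      κ (normSq z) * (h 0 / z) + κ (normSq z) * deriv h 0 + κ (normSq z) * (z * h2 z) := by
    intro z hz
    have := hne z hz
    rw [wirtBar_cutoff, hexp z]
    field_simp
    ring
  rw [setIntegral_congr_fun hpU.measurableSet hsplit]
  have i01 : IntegrableOn (fun z : ℂ => ((κ (normSq z) : ℝ) : ℂ) * (h 0 / z) +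
    κ (normSq z) * deriv h 0) (puncturedDisc r) := i0.add i1
  rw [integral_add i01 i2, integral_add i0 i1]
  have hfull : ∀ f : ℂ → ℂ, ∫ z in puncturedDisc r, ((κ (normSq z) : ℝ) : ℂ) * f z =
      ∫ z, ((κ (normSq z) : ℝ) : ℂ) * f z := fun f =>
    setIntegral_eq_integral_of_forall_compl_eq_zero fun z hz => by
      rw [hκK z fun hzK => hz (hKU hzK)]; simp
  -- The integrand is odd, the cutoff being radial.
  have v0 : ∫ z in puncturedDisc r, ((κ (normSq z) : ℝ) : ℂ) * (h 0 / z) = 0 := by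
    rw [hfull]
    have := integral_neg_eq_self (fun z : ℂ => ((κ (normSq z) : ℝ) : ℂ) * (h 0 / z)) volume
    simp only [normSq_neg, div_neg, mul_neg, integral_neg] at this
    exact self_eq_neg.1 this.symm
  have v1 : ∫ z in puncturedDisc r, ((κ (normSq z) : ℝ) : ℂ) * deriv h 0 = Real.pi * deriv h 0 := by
    rw [hfull fun _ => deriv h 0, integral_mul_const, integral_deriv_cutoff_normSq hs2 hst2]
  -- The integrand is `∂̄((cutoff - 1) h2)`. It vanishes at `0`, so the puncture can be filled in,
  -- and `(cutoff - 1) h2` has compact support in the full disc.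
  have v2 : ∫ z in puncturedDisc r, ((κ (normSq z) : ℝ) : ℂ) * (z * h2 z) = 0 := by
    rw [← setIntegral_eq_of_subset_of_forall_sdiff_eq_zero Metric.isOpen_ball.measurableSet hsub
      fun z hz => by
        have : z = 0 := by
          by_contra hcon
          exact hz.2 ⟨hz.1, hcon⟩
        simp [this]]
    have hu : ContDiffOn ℝ 1 (fun z => ((cutoff (s ^ 2) (t ^ 2) (normSq z) : ℝ) : ℂ) - 1)
        (Metric.ball 0 r) :=
      (contDiffOn_ofReal ((contDiff_cutoff_normSq _ _).contDiffOn.of_le (by norm_cast))).sub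
        contDiffOn_const
    have hh2' := contDiffOn_real_of_differentiableOn Metric.isOpen_ball d2
    have := setIntegral_wirtBar_eq_zero (Metric.isOpen_ball (x := (0 : ℂ)) (ε := r))
      (isCompact_closedBall (0 : ℂ) t) (Metric.closedBall_subset_ball htr) (hu.mul hh2') ?_
    · refine Eq.trans ?_ this
      refine setIntegral_congr_fun Metric.isOpen_ball.measurableSet fun z hz => ?_
      have hzn := Metric.isOpen_ball.mem_nhds hz
      have e1 := (hu.contDiffAt hzn).differentiableAt one_ne_zero
      have e2 := (hh2'.contDiffAt hzn).differentiableAt one_ne_zero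
      have e3 := wirtBar_of_hasDerivAt (d2.differentiableAt hzn).hasDerivAt
      have e4 : wirtBar (fun z => ((cutoff (s ^ 2) (t ^ 2) (normSq z) : ℝ) : ℂ) - 1) z =
          κ (normSq z) * z := by
        rw [wirtBar_sub _ (differentiableAt_const 1), wirtBar_const, wirtBar_cutoff, sub_zero]
        have := e1.add_const 1
        simpa using this
      change _ = wirtBar (fun z => (((cutoff (s ^ 2) (t ^ 2) (normSq z) : ℝ) : ℂ) - 1) * h2 z) z
      rw [wirtBar_mul e1 e2, e3, e4]
      ring
    · intro z _ hz
      rw [Metric.mem_closedBall, dist_zero_right, not_le] at hz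
      rw [cutoff_of_ge hst2]
      · simp
      · rw [normSq_eq_norm_sq]; gcongr
  rw [v0, v1, v2]
  ring

/-- The integral of any cutoff against `h(z)/z² dz` is the residue, up to a factor `π`. -/
lemma integral_wirtBar_residue {r s t : ℝ} (hs : 0 < s) (hst : s < t) (htr : t < r) {h : ℂ → ℂ}
    (hh : DifferentiableOn ℂ h (Metric.ball 0 r)) {g : ℂ → ℂ}
    (hg : ContDiffOn ℝ 1 g (puncturedDisc r))
    (hg0 : ∀ z ∈ puncturedDisc r, ‖z‖ < s → g z = 0)
    (hg1 : ∀ z ∈ puncturedDisc r, t < ‖z‖ → g z = 1) :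
    ∫ z in puncturedDisc r, wirtBar g z * (h z / z ^ 2) = Real.pi * deriv h 0 := by
  rw [← integral_wirtBar_cutoff hs hst htr hh]
  have ht : 0 ≤ t := by linarith
  have hst2 : s ^ 2 < t ^ 2 := by gcongr
  -- Comparison with a radial cutoff: `g - c` is supported in a compact annulus, on which `h/z²` is
  -- holomorphic, so `∂̄((g - c) h/z²)` has integral zero.
  set c : ℂ → ℂ := fun v => ((cutoff (s ^ 2) (t ^ 2) (normSq v) : ℝ) : ℂ) with hc
  have hpU := isOpen_puncturedDisc r
  have hcd : ContDiffOn ℝ 1 c (puncturedDisc r) :=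
    contDiffOn_ofReal ((contDiff_cutoff_normSq _ _).contDiffOn.of_le (by norm_cast))
  have hne : ∀ z ∈ puncturedDisc r, z ≠ 0 := fun z hz => hz.2
  have hsub : puncturedDisc r ⊆ Metric.ball 0 r := Set.sdiff_subset
  have ha : DifferentiableOn ℂ (fun z => h z / z ^ 2) (puncturedDisc r) :=
    (hh.mono hsub).div (differentiableOn_id.pow 2) fun z hz => pow_ne_zero 2 (hne z hz)
  have ha' := contDiffOn_real_of_differentiableOn hpU ha
  set K : Set ℂ := Metric.closedBall 0 t \ Metric.ball 0 s with hK
  have hKc : IsCompact K := (isCompact_closedBall 0 t).diff Metric.isOpen_ball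
  have hKU : K ⊆ puncturedDisc r := by
    intro z hz
    simp only [hK, Set.mem_sdiff, Metric.mem_closedBall, dist_zero_right, Metric.mem_ball, not_lt] at hz
    exact mem_puncturedDisc.2 ⟨by linarith, fun h0 => by rw [h0, norm_zero] at hz; linarith⟩
  have hnK : ∀ z, z ∉ K → ‖z‖ < s ∨ t < ‖z‖ := by
    intro z hz
    simp only [hK, Set.mem_sdiff, Metric.mem_closedBall, dist_zero_right, Metric.mem_ball, not_lt,
      not_and, not_le] at hz
    by_cases h : ‖z‖ ≤ t
    · exact Or.inl (hz h)
    · exact Or.inr (not_le.1 h)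
  have hgc : ∀ z ∈ puncturedDisc r, z ∉ K → g z = c z := by
    intro z hz hzK
    rcases hnK z hzK with h | h
    · rw [hg0 z hz h, hc]
      simp only
      rw [cutoff_of_le hst2, ofReal_zero]
      rw [normSq_eq_norm_sq]; gcongr
    · rw [hg1 z hz h, hc]
      simp only
      rw [cutoff_of_ge hst2, ofReal_one]
      rw [normSq_eq_norm_sq]; gcongr
  have hwirt : ∀ z ∈ puncturedDisc r, wirtBar (fun v => (g v - c v) * (h v / v ^ 2)) z =
      wirtBar g z * (h z / z ^ 2) - wirtBar c z * (h z / z ^ 2) := by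
    intro z hz
    have hzn := hpU.mem_nhds hz
    have e1 := (hg.contDiffAt hzn).differentiableAt one_ne_zero
    have e2 := (hcd.contDiffAt hzn).differentiableAt one_ne_zero
    have e3 := (ha'.contDiffAt hzn).differentiableAt one_ne_zero
    have e4 : DifferentiableAt ℝ (fun v => g v - c v) z := e1.sub e2
    rw [wirtBar_mul e4 e3, wirtBar_sub e1 e2,
      wirtBar_of_hasDerivAt (ha.differentiableAt hzn).hasDerivAt]
    ring
  have hzero : ∀ f : ℂ → ℂ, (∀ z ∈ puncturedDisc r, ‖z‖ < s → f z = 0) →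
      (∀ z ∈ puncturedDisc r, t < ‖z‖ → f z = 1) →
      ∀ z ∈ puncturedDisc r, z ∉ K → wirtBar f z * (h z / z ^ 2) = 0 := by
    intro f h0 h1 z hz hzK
    have : wirtBar f z = 0 := by
      rcases hnK z hzK with h | h
      · rw [wirtBar_congr (g := fun _ => 0), wirtBar_const]
        filter_upwards [hpU.mem_nhds hz, (isOpen_lt continuous_norm continuous_const).mem_nhds h]
          with v hv hv' using h0 v hv hv'
      · rw [wirtBar_congr (g := fun _ => 1), wirtBar_const]
        filter_upwards [hpU.mem_nhds hz, (isOpen_lt continuous_const continuous_norm).mem_nhds h]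
          with v hv hv' using h1 v hv hv'
    rw [this, zero_mul]
  have ig : IntegrableOn (fun z => wirtBar g z * (h z / z ^ 2)) (puncturedDisc r) :=
    integrableOn_of_continuousOn_of_compact hpU hKc hKU
      ((continuousOn_wirtBar hpU hg).mul ha.continuousOn) (hzero g hg0 hg1)
  have ic : IntegrableOn (fun z => wirtBar c z * (h z / z ^ 2)) (puncturedDisc r) := by
    refine integrableOn_of_continuousOn_of_compact hpU hKc hKU
      ((continuousOn_wirtBar hpU hcd).mul ha.continuousOn) (hzero c ?_ ?_)
    · intro z _ hz
      simp only [hc]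
      rw [cutoff_of_le hst2, ofReal_zero]
      rw [normSq_eq_norm_sq]; gcongr
    · intro z _ hz
      simp only [hc]
      rw [cutoff_of_ge hst2, ofReal_one]
      rw [normSq_eq_norm_sq]; gcongr
  have := setIntegral_wirtBar_eq_zero hpU hKc hKU ((hg.sub hcd).mul ha') fun z hz hzK => by
    change (g z - c z) * _ = 0
    rw [hgc z hz hzK, sub_self, zero_mul]
  rw [← sub_eq_zero, ← integral_sub ig ic, ← this]
  exact setIntegral_congr_fun hpU.measurableSet fun z hz => (hwirt z hz).symm

end

/-! ### Stokes' theorem for the flux form on the Riemann surface. -/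

section

open MeasureTheory Complex

lemma det_restrictScalars_toSpanSingleton (a : ℂ) :
    ((ContinuousLinearMap.toSpanSingleton ℂ a).restrictScalars ℝ).det = normSq a := by
  have h : LinearMap.det (((ContinuousLinearMap.toSpanSingleton ℂ a : ℂ →L[ℂ] ℂ) : ℂ →ₗ[ℂ] ℂ)) = a := by
    rw [LinearMap.det_ring]; simp
  change LinearMap.det ((((ContinuousLinearMap.toSpanSingleton ℂ a : ℂ →L[ℂ] ℂ) : ℂ →ₗ[ℂ] ℂ)).restrictScalars ℝ) = _
  rw [LinearMap.det_restrictScalars, h, Algebra.norm_complex_eq]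
  rfl

/-- Change of variables by an injective holomorphic map. -/
lemma integral_image_holomorphic {A : Set ℂ} (hA : MeasurableSet A) {τ τ' : ℂ → ℂ}
    (hτ : ∀ z ∈ A, HasDerivAt τ (τ' z) z) (hinj : Set.InjOn τ A) {η θ : ℂ → ℂ}
    (hη : ∀ z ∈ A, η z = (normSq (τ' z) : ℂ) * θ (τ z)) :
    ∫ z in τ '' A, θ z = ∫ z in A, η z := by
  rw [integral_image_eq_integral_abs_det_fderiv_smul volume hA
    (fun z hz => ((hτ z hz).hasFDerivAt.restrictScalars ℝ).hasFDerivWithinAt) hinj]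
  refine setIntegral_congr_fun hA fun z hz => ?_
  rw [det_restrictScalars_toSpanSingleton, abs_of_nonneg (normSq_nonneg _), hη z hz, real_smul]

lemma integrableOn_image_holomorphic {A : Set ℂ} (hA : MeasurableSet A) {τ τ' : ℂ → ℂ}
    (hτ : ∀ z ∈ A, HasDerivAt τ (τ' z) z) (hinj : Set.InjOn τ A) {η θ : ℂ → ℂ}
    (hη : ∀ z ∈ A, η z = (normSq (τ' z) : ℂ) * θ (τ z)) :
    IntegrableOn θ (τ '' A) ↔ IntegrableOn η A := by
  rw [integrableOn_image_iff_integrableOn_abs_det_fderiv_smul volume hA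
    (fun z hz => ((hτ z hz).hasFDerivAt.restrictScalars ℝ).hasFDerivWithinAt) hinj]
  refine integrableOn_congr_fun (fun z hz => ?_) hA
  rw [det_restrictScalars_toSpanSingleton, abs_of_nonneg (normSq_nonneg _), hη z hz, real_smul]

section manifold

variable {M : Type*} [TopologicalSpace M] [ChartedSpace ℂ M]

/-- Holomorphic transition maps are real smooth. The underlying real structure is the one that
carries partitions of unity. -/
lemma isManifold_real [IsManifold 𝓘(ℂ) ω M] : IsManifold 𝓘(ℝ, ℂ) ∞ M := by
  refine isManifold_of_contDiffOn _ _ _ fun e e' he he' => ?_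
  have h := (mem_groupoid_of_pregroupoid.1 (HasGroupoid.compatible (G := contDiffGroupoid ω 𝓘(ℂ)) he he')).1
  have h' : ContDiffOn ℂ ω (e.symm ≫ₕ e') (e.symm ≫ₕ e').source := by
    simpa [contDiffPregroupoid] using h
  simpa using (h'.restrict_scalars ℝ).of_le (by exact le_top)

/-- An injective holomorphic map `ψ` of the open set `V ⊆ ℂ` into the Riemann surface `M`. -/
structure IsParam (ψ : ℂ → M) (V : Set ℂ) : Prop where
  isOpen : IsOpen V
  continuousOn : ContinuousOn ψ V
  injOn : Set.InjOn ψ V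
  differentiableAt : ∀ q : M, ∀ z ∈ V, ψ z ∈ (chartAt ℂ q).source →
    DifferentiableAt ℂ (fun v => chartAt ℂ q (ψ v)) z

lemma isParam_of_mdifferentiableOn [IsManifold 𝓘(ℂ) ω M] {ψ : ℂ → M} {V : Set ℂ} (hV : IsOpen V)
    (hψ : MDifferentiableOn 𝓘(ℂ) 𝓘(ℂ) ψ V) (hinj : Set.InjOn ψ V) : IsParam ψ V where
  isOpen := hV
  continuousOn := hψ.continuousOn
  injOn := hinj
  differentiableAt q z hz hq := by
    have : IsManifold 𝓘(ℂ) 1 M := IsManifold.of_le (n := ω) le_top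
    rw [← mdifferentiableAt_iff_differentiableAt]
    exact (mdifferentiableAt_atlas (chart_mem_atlas ℂ q) hq).comp z
      ((hψ z hz).mdifferentiableAt (hV.mem_nhds hz))

lemma isParam_chartAt_symm [IsManifold 𝓘(ℂ) ω M] (p : M) :
    IsParam (chartAt ℂ p).symm (chartAt ℂ p).target :=
  isParam_of_mdifferentiableOn (chartAt ℂ p).open_target
    ((contMDiffOn_chart_symm (n := ω)).mdifferentiableOn (by simp)) (chartAt ℂ p).symm.injOn

lemma contDiffOn_comp_chartAt_symm [IsManifold 𝓘(ℝ, ℂ) ∞ M] {f : M → ℝ}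
    (hf : ContMDiff 𝓘(ℝ, ℂ) 𝓘(ℝ) ∞ f) (p : M) :
    ContDiffOn ℝ ∞ (fun z => f ((chartAt ℂ p).symm z)) (chartAt ℂ p).target := by
  rw [← contMDiffOn_iff_contDiffOn]
  exact hf.comp_contMDiffOn contMDiffOn_chart_symm

section param

variable {ψ : ℂ → M} {V : Set ℂ}

lemma IsParam.isOpen_preimage (hψ : IsParam ψ V) {S : Set M} (hS : IsOpen S) :
    IsOpen (V ∩ ψ ⁻¹' S) :=
  hψ.continuousOn.isOpen_inter_preimage hψ.isOpen hS

lemma IsParam.eventually_mem (hψ : IsParam ψ V) {S : Set M} (hS : IsOpen S) {z : ℂ} (hz : z ∈ V)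
    (hzS : ψ z ∈ S) : ∀ᶠ v in 𝓝 z, v ∈ V ∧ ψ v ∈ S :=
  (hψ.isOpen_preimage hS).mem_nhds ⟨hz, hzS⟩

lemma IsParam.eventuallyEq (hψ : IsParam ψ V) (q : M) {z : ℂ} (hz : z ∈ V)
    (hq : ψ z ∈ (chartAt ℂ q).source) :
    ∀ᶠ v in 𝓝 z, ψ v = (chartAt ℂ q).symm (chartAt ℂ q (ψ v)) := by
  filter_upwards [hψ.eventually_mem (chartAt ℂ q).open_source hz hq] with v hv
  exact ((chartAt ℂ q).left_inv hv.2).symm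

lemma IsParam.contDiffOn_comp [IsManifold 𝓘(ℝ, ℂ) ∞ M] (hψ : IsParam ψ V) {f : M → ℝ}
    (hf : ContMDiff 𝓘(ℝ, ℂ) 𝓘(ℝ) ∞ f) : ContDiffOn ℝ 1 (fun z => f (ψ z)) V := by
  intro z hz
  refine ContDiffAt.contDiffWithinAt ?_
  set q := ψ z
  have hq : ψ z ∈ (chartAt ℂ q).source := mem_chart_source ℂ q
  have hτ : DifferentiableOn ℂ (fun v => chartAt ℂ q (ψ v)) (V ∩ ψ ⁻¹' (chartAt ℂ q).source) :=
    fun v hv => (hψ.differentiableAt q v hv.1 hv.2).differentiableWithinAt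
  have ho := hψ.isOpen_preimage (chartAt ℂ q).open_source
  have h1 := (contDiffOn_real_of_differentiableOn ho hτ).contDiffAt (ho.mem_nhds ⟨hz, hq⟩)
  have h2 := (contDiffOn_comp_chartAt_symm hf q).contDiffAt
    ((chartAt ℂ q).open_target.mem_nhds ((chartAt ℂ q).map_source hq))
  have h3 := (h2.of_le (by norm_cast : (1 : WithTop ℕ∞) ≤ ∞)).comp z h1
  refine h3.congr_of_eventuallyEq ?_
  filter_upwards [hψ.eventuallyEq q hz hq] with v hv
  simp only [Function.comp_apply]
  rw [← hv]

end param

/-- The form `∂̄f ∧ α`, with `α` an entry of the flux form, in the parametrization `ψ`. -/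
def fluxDensity (X : M → UpperHalfSpace) (i j : Fin 2) (f : M → ℝ) (ψ : ℂ → M) (z : ℂ) : ℂ :=
  wirtBar (fun v => (f (ψ v) : ℂ)) z * fluxForm (fun v => (X (ψ v)).1) z i j

variable {X : M → UpperHalfSpace} {ψ : ℂ → M} {V : Set ℂ} {f : M → ℝ}

lemma IsBryantSurface.differentiableAt (hX : IsBryantSurface X) (q : M) {z : ℂ}
    (hz : z ∈ (chartAt ℂ q).target) : DifferentiableAt ℝ (inChart X q) z :=
  differentiableAt_of_smooth (chartAt ℂ q).open_target (hX q).smooth hz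

lemma differentiableAt_param (hX : IsBryantSurface X) (hψ : IsParam ψ V) {z : ℂ} (hz : z ∈ V) :
    DifferentiableAt ℝ (fun v => (X (ψ v)).1) z := by
  have hq : ψ z ∈ (chartAt ℂ (ψ z)).source := mem_chart_source ℂ (ψ z)
  have h1 := hX.differentiableAt (ψ z) ((chartAt ℂ (ψ z)).map_source hq)
  have h2 := (hψ.differentiableAt (ψ z) z hz hq).restrictScalars ℝ
  have h3 := h1.comp z h2
  refine h3.congr_of_eventuallyEq ?_
  filter_upwards [hψ.eventuallyEq (ψ z) hz hq] with v hv
  simp only [Function.comp_apply, inChart]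
  rw [← hv]

/-- The form `∂̄f ∧ α` has type (1,1): `∂̄f` contributes the conjugate of the derivative of the
transition map and `α` the derivative itself. -/
lemma fluxDensity_eq_mul [IsManifold 𝓘(ℝ, ℂ) ∞ M] (hX : IsBryantSurface X)
    (hf : ContMDiff 𝓘(ℝ, ℂ) 𝓘(ℝ) ∞ f) (hψ : IsParam ψ V) (i j : Fin 2) (q : M) {z : ℂ} (hz : z ∈ V)
    (hq : ψ z ∈ (chartAt ℂ q).source) :
    fluxDensity X i j f ψ z = (normSq (deriv (fun v => chartAt ℂ q (ψ v)) z) : ℂ) *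
      fluxDensity X i j f (chartAt ℂ q).symm (chartAt ℂ q (ψ z)) := by
  have hτ := (hψ.differentiableAt q z hz hq).hasDerivAt
  have ht := (chartAt ℂ q).map_source hq
  have he := hψ.eventuallyEq q hz hq
  have e1 : (fun v => (f (ψ v) : ℂ)) =ᶠ[𝓝 z]
      fun v => (f ((chartAt ℂ q).symm (chartAt ℂ q (ψ v))) : ℂ) := by
    filter_upwards [he] with v hv
    rw [← hv]
  have e2 : (fun v => (X (ψ v)).1) =ᶠ[𝓝 z] fun v => inChart X q (chartAt ℂ q (ψ v)) := by
    filter_upwards [he] with v hv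
    rw [inChart, ← hv]
  have d1 : DifferentiableAt ℝ (fun v => (f ((chartAt ℂ q).symm v) : ℂ)) (chartAt ℂ q (ψ z)) :=
    differentiableAt_of_smooth (chartAt ℂ q).open_target
      (contDiffOn_ofReal (contDiffOn_comp_chartAt_symm hf q)) ht
  rw [fluxDensity, fluxDensity, wirtBar_congr e1, fluxForm_congr e2,
    wirtBar_comp (f := fun v => (f ((chartAt ℂ q).symm v) : ℂ)) d1 hτ,
    fluxForm_comp (hX.differentiableAt q ht) (X _).2.ne' hτ, normSq_eq_conj_mul_self]
  simp only [Matrix.smul_apply, smul_eq_mul]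
  unfold inChart
  ring

lemma fluxDensity_eq_zero (i j : Fin 2) (hψ : IsParam ψ V) {S : Set M} (hS : IsOpen S)
    (hf : ∀ x ∈ S, f x = 0) {z : ℂ} (hz : z ∈ V) (hzS : ψ z ∈ S) :
    fluxDensity X i j f ψ z = 0 := by
  rw [fluxDensity, wirtBar_congr (g := fun _ => 0), wirtBar_const, zero_mul]
  filter_upwards [hψ.eventually_mem hS hz hzS] with v hv
  rw [hf _ hv.2, ofReal_zero]

lemma fluxDensity_sum [IsManifold 𝓘(ℝ, ℂ) ∞ M] (i j : Fin 2) (hψ : IsParam ψ V)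
    {T : Type*} [Fintype T] {f : T → M → ℝ}
    (hf : ∀ t, ContMDiff 𝓘(ℝ, ℂ) 𝓘(ℝ) ∞ (f t)) {z : ℂ} (hz : z ∈ V) :
    fluxDensity X i j (fun x => ∑ t, f t x) ψ z = ∑ t, fluxDensity X i j (f t) ψ z := by
  simp only [fluxDensity, ← Finset.sum_mul]
  congr 1
  rw [← wirtBar_sum]
  · simp
  · intro t _
    exact ((contDiffOn_ofReal (hψ.contDiffOn_comp (hf t))).contDiffAt
      (hψ.isOpen.mem_nhds hz)).differentiableAt one_ne_zero

/-- Serves at points where a sum of partition functions reaches its bound `1`. Such points need not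
be interior to the set where the sum equals `1`, but the differential vanishes there all the same.
-/
lemma fluxDensity_eq_zero_of_max [IsManifold 𝓘(ℝ, ℂ) ∞ M] (i j : Fin 2) (hψ : IsParam ψ V)
    (hf : ContMDiff 𝓘(ℝ, ℂ) 𝓘(ℝ) ∞ f) {z : ℂ} (hz : z ∈ V) (hmax : ∀ x, f x ≤ f (ψ z)) :
    fluxDensity X i j f ψ z = 0 := by
  rw [fluxDensity, wirtBar_ofReal (f := fun v => f (ψ v)), zero_mul]
  · exact IsLocalMax.fderiv_eq_zero (Filter.Eventually.of_forall fun v => hmax (ψ v))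
  · exact ((hψ.contDiffOn_comp hf).contDiffAt (hψ.isOpen.mem_nhds hz)).differentiableAt one_ne_zero

section transition

variable [IsManifold 𝓘(ℝ, ℂ) ∞ M]

/-- The integral of `w ∂̄f ∧ α` does not depend on the parametrization. -/
lemma integral_fluxDensity_chart (hX : IsBryantSurface X)
    (hf : ContMDiff 𝓘(ℝ, ℂ) 𝓘(ℝ) ∞ f) (hψ : IsParam ψ V) (i j : Fin 2) (q : M)
    {A : Set ℂ} (hA : MeasurableSet A) (hAV : A ⊆ V)
    (hAq : ∀ z ∈ A, ψ z ∈ (chartAt ℂ q).source) (w : M → ℂ) :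
    ∫ z in (fun v => chartAt ℂ q (ψ v)) '' A, w ((chartAt ℂ q).symm z) *
      fluxDensity X i j f (chartAt ℂ q).symm z = ∫ z in A, w (ψ z) * fluxDensity X i j f ψ z := by
  refine integral_image_holomorphic hA
    (fun z hz => (hψ.differentiableAt q z (hAV hz) (hAq z hz)).hasDerivAt) ?_ fun z hz => ?_
  · intro x hx y hy hxy
    exact hψ.injOn (hAV hx) (hAV hy) ((chartAt ℂ q).injOn (hAq x hx) (hAq y hy) hxy)
  · rw [fluxDensity_eq_mul hX hf hψ i j q (hAV hz) (hAq z hz), (chartAt ℂ q).left_inv (hAq z hz)]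
    ring

lemma integrableOn_fluxDensity_chart (hX : IsBryantSurface X)
    (hf : ContMDiff 𝓘(ℝ, ℂ) 𝓘(ℝ) ∞ f) (hψ : IsParam ψ V) (i j : Fin 2) (q : M)
    {A : Set ℂ} (hA : MeasurableSet A) (hAV : A ⊆ V)
    (hAq : ∀ z ∈ A, ψ z ∈ (chartAt ℂ q).source) (w : M → ℂ) :
    IntegrableOn (fun z => w ((chartAt ℂ q).symm z) * fluxDensity X i j f (chartAt ℂ q).symm z)
      ((fun v => chartAt ℂ q (ψ v)) '' A) ↔
    IntegrableOn (fun z => w (ψ z) * fluxDensity X i j f ψ z) A := by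
  refine integrableOn_image_holomorphic hA
    (fun z hz => (hψ.differentiableAt q z (hAV hz) (hAq z hz)).hasDerivAt) ?_ fun z hz => ?_
  · intro x hx y hy hxy
    exact hψ.injOn (hAV hx) (hAV hy) ((chartAt ℂ q).injOn (hAq x hx) (hAq y hy) hxy)
  · rw [fluxDensity_eq_mul hX hf hψ i j q (hAV hz) (hAq z hz), (chartAt ℂ q).left_inv (hAq z hz)]
    ring

end transition

lemma image_chartAt_param (ψ : ℂ → M) (V : Set ℂ) (q : M) (Q : Set M) :
    (fun v => chartAt ℂ q (ψ v)) '' (V ∩ ψ ⁻¹' ((chartAt ℂ q).source ∩ Q)) =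
      (chartAt ℂ q).target ∩ (chartAt ℂ q).symm ⁻¹' (ψ '' V ∩ Q) := by
  ext z
  constructor
  · rintro ⟨v, ⟨hv, hvq, hvQ⟩, rfl⟩
    refine ⟨(chartAt ℂ q).map_source hvq, ?_⟩
    simp only [Set.mem_preimage, (chartAt ℂ q).left_inv hvq]
    exact ⟨⟨v, hv, rfl⟩, hvQ⟩
  · rintro ⟨hz, ⟨v, hv, hvz⟩, hzQ⟩
    refine ⟨v, ⟨hv, ?_, ?_⟩, ?_⟩
    · rw [hvz]; exact (chartAt ℂ q).map_target hz
    · rw [hvz]; exact hzQ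
    · simp only [hvz, (chartAt ℂ q).right_inv hz]

/-- An injective continuous image of an open set is Borel, so no open mapping theorem is needed. -/
lemma measurableSet_chartAt_param (hψ : IsParam ψ V) (q : M) :
    MeasurableSet ((chartAt ℂ q).target ∩ (chartAt ℂ q).symm ⁻¹' (ψ '' V)) := by
  have h := image_chartAt_param ψ V q Set.univ
  simp only [Set.inter_univ] at h
  rw [← h]
  refine (hψ.isOpen_preimage (chartAt ℂ q).open_source).measurableSet.image_of_continuousOn_injOn
    ?_ ?_
  · exact fun z hz => (hψ.differentiableAt q z hz.1 hz.2).continuousAt.continuousWithinAt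
  · intro x hx y hy hxy
    exact hψ.injOn hx.1 hy.1 ((chartAt ℂ q).injOn hx.2 hy.2 hxy)

section chartSupport

variable [IsManifold 𝓘(ℝ, ℂ) ∞ M]

/-- Stokes' theorem for `f α`, with `f` supported in a chart. -/
lemma integral_fluxDensity_eq_zero (hX : IsBryantSurface X)
    (hf : ContMDiff 𝓘(ℝ, ℂ) 𝓘(ℝ) ∞ f) (i j : Fin 2) (q : M) {C : Set M} (hC : IsCompact C)
    (hCq : C ⊆ (chartAt ℂ q).source) (hfC : ∀ x, x ∉ C → f x = 0) :
    ∫ z in (chartAt ℂ q).target, fluxDensity X i j f (chartAt ℂ q).symm z = 0 := by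
  have ho := (chartAt ℂ q).open_target
  have hs := contDiffOn_ofReal (contDiffOn_comp_chartAt_symm hf q)
  have ha := (hX q).differentiableOn_fluxForm ho (fun z _ => (X _).2) i j
  have ha' := contDiffOn_real_of_differentiableOn ho ha
  have h := setIntegral_wirtBar_eq_zero ho (hC.image_of_continuousOn
    ((chartAt ℂ q).continuousOn.mono hCq)) ?_ ((hs.of_le (by norm_cast)).mul ha') ?_
  · refine Eq.trans (setIntegral_congr_fun ho.measurableSet fun z hz => ?_) h
    have e := wirtBar_mul (differentiableAt_of_smooth ho hs hz)
      ((ha'.contDiffAt (ho.mem_nhds hz)).differentiableAt one_ne_zero)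
    refine Eq.trans ?_ e.symm
    rw [wirtBar_of_hasDerivAt (ha.differentiableAt (ho.mem_nhds hz)).hasDerivAt, mul_zero, add_zero]
    rfl
  · rintro _ ⟨x, hx, rfl⟩
    exact (chartAt ℂ q).map_source (hCq hx)
  · intro z hz hzC
    rw [hfC, ofReal_zero, zero_mul]
    exact fun hm => hzC ⟨_, hm, (chartAt ℂ q).right_inv hz⟩

/-- The weight `w` will be `1` or another function of the partition. -/
lemma integrableOn_mul_fluxDensity [T2Space M] (hX : IsBryantSurface X)
    (hf : ContMDiff 𝓘(ℝ, ℂ) 𝓘(ℝ) ∞ f) (i j : Fin 2) (q : M) {C : Set M} (hC : IsCompact C)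
    (hCq : C ⊆ (chartAt ℂ q).source) (hfC : ∀ x, x ∉ C → f x = 0) {w : M → ℂ} (hw : Continuous w) :
    IntegrableOn (fun z => w ((chartAt ℂ q).symm z) * fluxDensity X i j f (chartAt ℂ q).symm z)
      (chartAt ℂ q).target := by
  have ho := (chartAt ℂ q).open_target
  have hs := contDiffOn_ofReal (contDiffOn_comp_chartAt_symm hf q)
  have ha := (hX q).differentiableOn_fluxForm ho (fun z _ => (X _).2) i j
  refine integrableOn_of_continuousOn_of_compact ho (hC.image_of_continuousOn
    ((chartAt ℂ q).continuousOn.mono hCq)) ?_ ((hw.comp_continuousOn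
      (chartAt ℂ q).continuousOn_symm).mul ((continuousOn_wirtBar ho (hs.of_le (by norm_cast))).mul
      ha.continuousOn)) ?_
  · rintro _ ⟨x, hx, rfl⟩
    exact (chartAt ℂ q).map_source (hCq hx)
  · intro z hz hzC
    have := wirtBar_congr (f := fun v => (f ((chartAt ℂ q).symm v) : ℂ)) (g := fun _ => 0) (z := z) ?_
    · rw [fluxDensity, this, wirtBar_const, zero_mul, mul_zero]
    · have hzC' : (chartAt ℂ q).symm z ∈ Cᶜ := fun hm => hzC ⟨_, hm, (chartAt ℂ q).right_inv hz⟩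
      filter_upwards [((chartAt ℂ q).continuousOn_symm.isOpen_inter_preimage ho
        hC.isClosed.isOpen_compl).mem_nhds ⟨hz, hzC'⟩] with v hv
      rw [hfC _ hv.2, ofReal_zero]

end chartSupport

/-- Stokes' theorem for `ρ α`, with `ρ` a sum of functions supported in charts that is constant
out of the images of the parametrizations `φ k`. -/
theorem sum_integral_fluxDensity_eq_zero [T2Space M] [IsManifold 𝓘(ℂ) ω M]
    {ι T : Type*} [Fintype ι] [Fintype T] (hX : IsBryantSurface X) (i j : Fin 2)
    {p : T → M} {f : T → M → ℝ} {C : T → Set M}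
    (hf : ∀ t, ContMDiff 𝓘(ℝ, ℂ) 𝓘(ℝ) ∞ (f t))
    (hle : ∀ x, ∑ t, f t x ≤ 1)
    (hC : ∀ t, IsCompact (C t)) (hCs : ∀ t, C t ⊆ (chartAt ℂ (p t)).source)
    (hfC : ∀ t x, x ∉ C t → f t x = 0)
    {φ : ι → ℂ → M} {W : ι → Set ℂ} (hφ : ∀ k, IsParam (φ k) (W k))
    (hdisj : Pairwise fun k l => Disjoint (φ k '' W k) (φ l '' W l))
    (hone : ∀ x, (∀ k, x ∉ φ k '' W k) → ∑ t, f t x = 1) :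
    ∑ k, ∫ z in W k, fluxDensity X i j (fun x => ∑ t, f t x) (φ k) z = 0 := by
  have := isManifold_real (M := M)
  -- `R` is what the parametrized discs leave over. Each chart domain is cut into its part in `R`
  -- (`G t`) and its parts in the discs (`D t k`).
  set R : Set M := (⋃ k, φ k '' W k)ᶜ with hR
  have hRone : ∀ x ∈ R, ∑ t, f t x = 1 := fun x hx => hone x fun k hk =>
    hx (Set.mem_iUnion.2 ⟨k, hk⟩)
  set D : T → ι → Set ℂ := fun t k =>
    (chartAt ℂ (p t)).target ∩ (chartAt ℂ (p t)).symm ⁻¹' (φ k '' W k) with hD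
  set G : T → Set ℂ := fun t => (chartAt ℂ (p t)).target ∩ (chartAt ℂ (p t)).symm ⁻¹' R with hG
  have hDm : ∀ t k, MeasurableSet (D t k) := fun t k => measurableSet_chartAt_param (hφ k) (p t)
  have hDt : ∀ t k, D t k ⊆ (chartAt ℂ (p t)).target := fun t k => Set.inter_subset_left
  have hGt : ∀ t, G t ⊆ (chartAt ℂ (p t)).target := fun t => Set.inter_subset_left
  have hGD : ∀ t, G t = (chartAt ℂ (p t)).target \ ⋃ k, D t k := by
    intro t
    ext z
    simp only [hG, hD, hR, Set.mem_inter_iff, Set.mem_preimage, Set.mem_compl_iff, Set.mem_iUnion,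
      Set.mem_sdiff, not_exists, not_and]
    constructor
    · exact fun h => ⟨h.1, fun k _ => h.2 k⟩
    · exact fun h => ⟨h.1, fun k => h.2 k h.1⟩
  have hGm : ∀ t, MeasurableSet (G t) := fun t => by
    rw [hGD]
    exact (chartAt ℂ (p t)).open_target.measurableSet.diff (MeasurableSet.iUnion (hDm t))
  have hint : ∀ t (w : M → ℂ), Continuous w → IntegrableOn (fun z => w ((chartAt ℂ (p t)).symm z) *
      fluxDensity X i j (f t) (chartAt ℂ (p t)).symm z) (chartAt ℂ (p t)).target := fun t w hw =>
    integrableOn_mul_fluxDensity hX (hf t) i j (p t) (hC t) (hCs t) (hfC t) hw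
  have hint1 : ∀ t, IntegrableOn (fluxDensity X i j (f t) (chartAt ℂ (p t)).symm)
      (chartAt ℂ (p t)).target := fun t => by simpa using hint t (fun _ => 1) continuous_const
  -- the part of the support of `f t` in the image of `φ k`
  have hAint : ∀ t k, MeasurableSet (W k ∩ φ k ⁻¹' (chartAt ℂ (p t)).source) := fun t k =>
    ((hφ k).isOpen_preimage (chartAt ℂ (p t)).open_source).measurableSet
  have himg : ∀ t k, (fun v => chartAt ℂ (p t) (φ k v)) '' (W k ∩ φ k ⁻¹' (chartAt ℂ (p t)).source) =
      D t k := fun t k => by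
    have := image_chartAt_param (φ k) (W k) (p t) Set.univ
    simpa only [Set.inter_univ] using this
  have hoff : ∀ t k, ∀ z ∈ W k \ (W k ∩ φ k ⁻¹' (chartAt ℂ (p t)).source),
      fluxDensity X i j (f t) (φ k) z = 0 := fun t k z hz =>
    fluxDensity_eq_zero i j (hφ k) (hC t).isClosed.isOpen_compl (hfC t) hz.1 fun h =>
      hz.2 ⟨hz.1, hCs t h⟩
  have hWint : ∀ t k, IntegrableOn (fluxDensity X i j (f t) (φ k)) (W k) := by
    intro t k
    have h1 := (integrableOn_fluxDensity_chart hX (hf t) (hφ k) i j (p t) (hAint t k)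
      Set.inter_subset_left (fun z hz => hz.2) (fun _ => 1)).1 (by
        rw [himg]; simpa using (hint1 t).mono_set (hDt t k))
    simp only [one_mul] at h1
    exact h1.of_forall_sdiff_eq_zero (hφ k).isOpen.measurableSet (hoff t k)
  have hWeq : ∀ t k, ∫ z in D t k, fluxDensity X i j (f t) (chartAt ℂ (p t)).symm z =
      ∫ z in W k, fluxDensity X i j (f t) (φ k) z := by
    intro t k
    have h1 := integral_fluxDensity_chart hX (hf t) (hφ k) i j (p t) (hAint t k)
      Set.inter_subset_left (fun z hz => hz.2) (fun _ => 1)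
    rw [himg] at h1
    simp only [one_mul] at h1
    rw [h1]
    exact (setIntegral_eq_of_subset_of_forall_sdiff_eq_zero (hφ k).isOpen.measurableSet
      Set.inter_subset_left (hoff t k)).symm
  -- Stokes' theorem in the chart at `p t`, with the disc parts carried to the discs by the change
  -- of variables.
  have hsplit : ∀ t, (∫ z in G t, fluxDensity X i j (f t) (chartAt ℂ (p t)).symm z) +
      ∑ k, ∫ z in W k, fluxDensity X i j (f t) (φ k) z = 0 := by
    intro t
    have h0 := integral_fluxDensity_eq_zero hX (hf t) i j (p t) (hC t) (hCs t) (hfC t)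
    have hunion : (chartAt ℂ (p t)).target = G t ∪ ⋃ k, D t k := by
      rw [hGD, Set.sdiff_union_of_subset (Set.iUnion_subset (hDt t))]
    have hDd : Pairwise (Function.onFun Disjoint (D t)) := fun k l hkl =>
      Set.disjoint_left.2 fun z hz hz' => Set.disjoint_left.1 (hdisj hkl) hz.2 hz'.2
    rw [hunion, setIntegral_union (by rw [hGD]; exact Set.disjoint_sdiff_left)
      (MeasurableSet.iUnion (hDm t)) ((hint1 t).mono_set (hGt t))
      ((hint1 t).mono_set (Set.iUnion_subset (hDt t))),
      integral_iUnion_fintype (hDm t) hDd fun k => (hint1 t).mono_set (hDt t k)] at h0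
    simpa only [hWeq] using h0
  -- the overlap of the charts at `p s` and `p t`, seen in the chart at `p s`
  set A : T → T → Set ℂ := fun s t => (chartAt ℂ (p s)).target ∩
    (chartAt ℂ (p s)).symm ⁻¹' ((chartAt ℂ (p t)).source ∩ R) with hA
  have hAG : ∀ s t, A s t ⊆ G s := fun s t z hz => ⟨hz.1, hz.2.2⟩
  have hBG : ∀ s t, A t s ⊆ G t := fun s t => hAG t s
  have hAm : ∀ s t, MeasurableSet (A s t) := by
    intro s t
    have : A s t = ((chartAt ℂ (p s)).target ∩ (chartAt ℂ (p s)).symm ⁻¹' (chartAt ℂ (p t)).source) ∩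
        G s := by
      ext z
      exact ⟨fun h => ⟨⟨h.1, h.2.1⟩, h.1, h.2.2⟩, fun h => ⟨h.1.1, h.1.2, h.2.2⟩⟩
    rw [this]
    exact ((isParam_chartAt_symm (p s)).isOpen_preimage
      (chartAt ℂ (p t)).open_source).measurableSet.inter (hGm s)
  have himgA : ∀ s t, (fun v => chartAt ℂ (p t) ((chartAt ℂ (p s)).symm v)) '' A s t = A t s := by
    intro s t
    have := image_chartAt_param (chartAt ℂ (p s)).symm (chartAt ℂ (p s)).target (p t) R
    rwa [(chartAt ℂ (p s)).symm_image_target_eq_source] at this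
  have hAoff : ∀ s t, ∀ z ∈ G s \ A s t, (f s ((chartAt ℂ (p s)).symm z) : ℂ) *
      fluxDensity X i j (f t) (chartAt ℂ (p s)).symm z = 0 := fun s t z hz => by
    rw [fluxDensity_eq_zero i j (isParam_chartAt_symm (p s)) (hC t).isClosed.isOpen_compl (hfC t)
      hz.1.1 fun h => hz.2 ⟨hz.1.1, hCs t h, hz.1.2⟩, mul_zero]
  have hBoff : ∀ s t, ∀ z ∈ G t \ A t s, (f s ((chartAt ℂ (p t)).symm z) : ℂ) *
      fluxDensity X i j (f t) (chartAt ℂ (p t)).symm z = 0 := fun s t z hz => by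
    rw [hfC s _ fun h => hz.2 ⟨hz.1.1, hCs s h, hz.1.2⟩, ofReal_zero, zero_mul]
  have hfcont : ∀ s, Continuous fun x => (f s x : ℂ) := fun s =>
    continuous_ofReal.comp (hf s).continuous
  -- Both integrands vanish off the overlap of the two charts: one by the support of `f s`, the
  -- other by that of `f t`. On the overlap they are the same (1,1)-form.
  have hweight : ∀ s t, ∫ z in G t, (f s ((chartAt ℂ (p t)).symm z) : ℂ) *
      fluxDensity X i j (f t) (chartAt ℂ (p t)).symm z =
      ∫ z in G s, (f s ((chartAt ℂ (p s)).symm z) : ℂ) *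
      fluxDensity X i j (f t) (chartAt ℂ (p s)).symm z := by
    intro s t
    rw [setIntegral_eq_of_subset_of_forall_sdiff_eq_zero (hGm t) (hBG s t) (hBoff s t), ← himgA,
      integral_fluxDensity_chart hX (hf t) (isParam_chartAt_symm (p s)) i j (p t) (hAm s t)
        Set.inter_subset_left (fun z hz => hz.2.1) (fun x => (f s x : ℂ))]
    exact (setIntegral_eq_of_subset_of_forall_sdiff_eq_zero (hGm s) (hAG s t) (hAoff s t)).symm
  have hweightint : ∀ s t, IntegrableOn (fun z => (f s ((chartAt ℂ (p s)).symm z) : ℂ) *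
      fluxDensity X i j (f t) (chartAt ℂ (p s)).symm z) (G s) := by
    intro s t
    refine IntegrableOn.of_forall_sdiff_eq_zero ?_ (hGm s) (hAoff s t)
    rw [← integrableOn_fluxDensity_chart hX (hf t) (isParam_chartAt_symm (p s)) i j (p t) (hAm s t)
        Set.inter_subset_left (fun z hz => hz.2.1) (fun x => (f s x : ℂ)), himgA]
    exact (hint t (fun x => (f s x : ℂ)) (hfcont s)).mono_set
      (Set.inter_subset_left)
  -- This plays the role of `∫_R ∂̄ρ ∧ α = 0`, for `ρ = ∑ f t`, when integrals exist only in charts.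
  -- Insert `1 = ∑ f s` on `R`, move each term to the chart at `p s`, and sum over `t` first: `∂̄ρ =
  -- 0` on `R`, where `ρ` is maximal.
  have hGsum : ∑ t, ∫ z in G t, fluxDensity X i j (f t) (chartAt ℂ (p t)).symm z = 0 := by
    calc ∑ t, ∫ z in G t, fluxDensity X i j (f t) (chartAt ℂ (p t)).symm z
        = ∑ t, ∑ s, ∫ z in G t, (f s ((chartAt ℂ (p t)).symm z) : ℂ) *
          fluxDensity X i j (f t) (chartAt ℂ (p t)).symm z := by
          refine Finset.sum_congr rfl fun t _ => ?_
          rw [← integral_finsetSum _ fun s _ =>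
            (hint t (fun x => (f s x : ℂ)) (hfcont s)).mono_set (hGt t)]
          refine setIntegral_congr_fun (hGm t) fun z hz => ?_
          simp only [← Finset.sum_mul, ← ofReal_sum]
          rw [hRone _ hz.2, ofReal_one, one_mul]
      _ = ∑ s, ∑ t, ∫ z in G s, (f s ((chartAt ℂ (p s)).symm z) : ℂ) *
          fluxDensity X i j (f t) (chartAt ℂ (p s)).symm z := by
          rw [Finset.sum_comm]
          exact Finset.sum_congr rfl fun s _ => Finset.sum_congr rfl fun t _ => hweight s t
      _ = 0 := by
          refine Finset.sum_eq_zero fun s _ => ?_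
          rw [← integral_finsetSum _ fun t _ => hweightint s t]
          refine setIntegral_eq_zero_of_forall_eq_zero fun z hz => ?_
          rw [← Finset.mul_sum, ← fluxDensity_sum i j (isParam_chartAt_symm (p s)) hf hz.1,
            fluxDensity_eq_zero_of_max i j (isParam_chartAt_symm (p s))
              (ContMDiff.sum fun t _ => hf t) hz.1, mul_zero]
          intro x
          rw [hRone _ hz.2]
          exact hle x
  calc ∑ k, ∫ z in W k, fluxDensity X i j (fun x => ∑ t, f t x) (φ k) z
      = ∑ k, ∑ t, ∫ z in W k, fluxDensity X i j (f t) (φ k) z := by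
        refine Finset.sum_congr rfl fun k _ => ?_
        rw [setIntegral_congr_fun (hφ k).isOpen.measurableSet fun z hz =>
          fluxDensity_sum i j (hφ k) hf hz]
        exact integral_finsetSum _ fun t _ => hWint t k
    _ = ∑ t, ((∫ z in G t, fluxDensity X i j (f t) (chartAt ℂ (p t)).symm z) +
      ∑ k, ∫ z in W k, fluxDensity X i j (f t) (φ k) z) := by
        rw [Finset.sum_add_distrib, hGsum, zero_add, Finset.sum_comm]
    _ = 0 := Finset.sum_eq_zero fun t _ => hsplit t

end manifold

end

/-! ### The residue theorem on a surface with punctured discs as ends. -/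

section

open MeasureTheory Complex

variable {M : Type*} [TopologicalSpace M] [ChartedSpace ℂ M]

/-- A smooth partition of unity of a compact set, by finitely many functions with compact supports
in chart domains. -/
lemma exists_partition [T2Space M] [SecondCountableTopology M] [IsManifold 𝓘(ℂ) ω M] {K : Set M}
    (hK : IsCompact K) : ∃ (T : Finset M) (f : T → M → ℝ) (C : T → Set M),
      (∀ t, ContMDiff 𝓘(ℝ, ℂ) 𝓘(ℝ) ∞ (f t)) ∧ (∀ x, ∑ t, f t x ≤ 1) ∧
      (∀ x ∈ K, ∑ t, f t x = 1) ∧ (∀ t, IsCompact (C t)) ∧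
      (∀ t : T, C t ⊆ (chartAt ℂ (t : M)).source) ∧ ∀ t x, x ∉ C t → f t x = 0 := by
  have := isManifold_real (M := M)
  have : LocallyCompactSpace M := ChartedSpace.locallyCompactSpace ℂ M
  choose C hC hCi hCs using fun x : M =>
    exists_compact_subset (chartAt ℂ x).open_source (mem_chart_source ℂ x)
  obtain ⟨T, -, hT⟩ := hK.elim_nhds_subcover (fun x => interior (C x)) fun x _ =>
    isOpen_interior.mem_nhds (hCi x)
  obtain ⟨f, hf⟩ := SmoothPartitionOfUnity.exists_isSubordinate 𝓘(ℝ, ℂ) hK.isClosed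
    (fun t : T => interior (C t)) (fun _ => isOpen_interior) (by
      intro x hx
      obtain ⟨t, ht, hxt⟩ := Set.mem_iUnion₂.1 (hT hx)
      exact Set.mem_iUnion.2 ⟨⟨t, ht⟩, hxt⟩)
  refine ⟨T, fun t x => f t x, fun t => C t, fun t => (f t).contMDiff, fun x => ?_, fun x hx => ?_,
    fun t => hC t, fun t => hCs t, fun t x hx => ?_⟩
  · rw [← finsum_eq_sum_of_fintype]
    exact f.sum_le_one x
  · rw [← finsum_eq_sum_of_fintype]
    exact f.sum_eq_one hx
  · by_contra hne
    exact hx (interior_subset (hf t (subset_tsupport _ hne)))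

/-- The residue theorem on a Bryant surface whose ends are punctured discs: an entry of the flux
form that has at most double poles at the ends has zero sum of residues. -/
theorem sum_residue_eq_zero [T2Space M] [SecondCountableTopology M] [IsManifold 𝓘(ℂ) ω M]
    {ι : Type*} [Fintype ι] {X : M → UpperHalfSpace} (hX : IsBryantSurface X) {E : ι → Set M}
    (hdisj : Pairwise fun k l => Disjoint (E k) (E l)) (hcompl : IsCompact (⋃ k, E k)ᶜ)
    {φ : ι → ℂ → M} {r : ι → ℝ} (hφ : ∀ k, IsEndParametrization (E k) (r k) (φ k)) (i j : Fin 2)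
    {h : ι → ℂ → ℂ} (hh : ∀ k, DifferentiableOn ℂ (h k) (Metric.ball 0 (r k)))
    (hflux : ∀ k, ∀ z ∈ puncturedDisc (r k),
      fluxForm (fun v => (X (φ k v)).1) z i j = h k z / z ^ 2) :
    ∑ k, deriv (h k) 0 = 0 := by
  have := isManifold_real (M := M)
  have hrpos : ∀ k, 0 < r k / 2 := fun k => half_pos (hφ k).pos
  have hrlt : ∀ k, r k / 2 < r k := fun k => half_lt_self (hφ k).pos
  choose K hK hKs using fun k => (hφ k).covers (r k / 2) (hrpos k) (hrlt k)
  -- The partition sums to `1` on a compact set containing everything outside the half discs, so the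
  -- hypothesis of Stokes' theorem holds for the full discs as well.
  obtain ⟨T, f, C, hf, hle, hone, hC, hCs, hfC⟩ :=
    exists_partition (hcompl.union (isCompact_iUnion hK))
  have hnot : ∀ x, (∀ k, x ∉ φ k '' puncturedDisc (r k / 2)) → ∑ t, f t x = 1 := by
    intro x hx
    refine hone x ?_
    by_cases hxE : x ∈ ⋃ k, E k
    · obtain ⟨k, hk⟩ := Set.mem_iUnion.1 hxE
      exact Or.inr (Set.mem_iUnion.2 ⟨k, hKs k ⟨hk, hx k⟩⟩)
    · exact Or.inl hxE
  have hparam : ∀ k, IsParam (φ k) (puncturedDisc (r k)) := fun k =>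
    isParam_of_mdifferentiableOn (isOpen_puncturedDisc _) (hφ k).holomorphic (hφ k).injOn
  have hsub : ∀ k, puncturedDisc (r k / 2) ⊆ puncturedDisc (r k) := fun k =>
    Set.sdiff_subset_sdiff_left (Metric.ball_subset_ball (hrlt k).le)
  have himg : ∀ k, φ k '' puncturedDisc (r k) ⊆ E k := fun k => (hφ k).mapsTo.image_subset
  have hsum := sum_integral_fluxDensity_eq_zero hX i j hf hle hC hCs hfC hparam
    (fun k l hkl => (hdisj hkl).mono (himg k) (himg l))
    fun x hx => hnot x fun k hk => hx k (Set.image_mono (hsub k) hk)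
  have hρ : ContMDiff 𝓘(ℝ, ℂ) 𝓘(ℝ) ∞ (fun x => ∑ t, f t x) := ContMDiff.sum fun t _ => hf t
  have hres : ∀ k, ∫ z in puncturedDisc (r k), fluxDensity X i j (fun x => ∑ t, f t x) (φ k) z =
      Real.pi * deriv (h k) 0 := by
    intro k
    -- The supports are compact and the puncture is sent to infinity, so the sum of the partition
    -- vanishes near the puncture.
    have hnear : ∀ᶠ z in 𝓝[≠] (0 : ℂ), φ k z ∉ ⋃ t, C t := by
      have := (hφ k).tendsto.eventually (isCompact_iUnion hC).compl_mem_cocompact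
      exact this
    obtain ⟨s, hs, hsz⟩ := Metric.mem_nhdsWithin_iff.1 hnear
    have hs' : 0 < min s (r k / 4) := lt_min hs (by linarith [hrpos k])
    rw [← integral_wirtBar_residue hs' (t := r k / 2)
      (lt_of_le_of_lt (min_le_right _ _) (by linarith [hrpos k])) (hrlt k) (hh k)
      (contDiffOn_ofReal ((hparam k).contDiffOn_comp hρ)) ?_ ?_]
    · exact setIntegral_congr_fun (isOpen_puncturedDisc _).measurableSet fun z hz => by
        rw [fluxDensity, hflux k z hz]
    · intro z hz hzs
      have : φ k z ∉ ⋃ t, C t := hsz ⟨by simpa using hzs.trans_le (min_le_left _ _), hz.2⟩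
      rw [Finset.sum_eq_zero fun t _ => hfC t _ fun ht => this (Set.mem_iUnion.2 ⟨t, ht⟩), ofReal_zero]
    -- A point beyond the half radius lies in no half disc: not in its own, by injectivity, and not
    -- in another, since the ends are disjoint.
    · intro z hz hzr
      rw [hnot, ofReal_one]
      rintro l ⟨v, hv, hvz⟩
      by_cases hkl : l = k
      · subst hkl
        rw [(hφ l).injOn (hsub l hv) hz hvz] at hv
        exact absurd (mem_puncturedDisc.1 hv).1 (not_lt.2 hzr.le)
      · refine Set.disjoint_left.1 (hdisj hkl) (himg l ⟨v, hsub l hv, rfl⟩) ?_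
        rw [hvz]
        exact himg k ⟨z, hz, rfl⟩
  simp only [hres, ← Finset.mul_sum] at hsum
  exact (mul_eq_zero.1 hsum).resolve_left (by exact_mod_cast Real.pi_ne_zero)

end

/-! ### Isometries and holomorphic frames in the Minkowski model. -/

section

open Complex

lemma isHermitian_toHermitian (p : ℂ × ℝ) : (toHermitian p)ᴴ = toHermitian p := by
  ext i j
  fin_cases i <;> fin_cases j <;> simp [toHermitian, mul_comm]

lemma det_toHermitian {p : ℂ × ℝ} (hp : p.2 ≠ 0) : (toHermitian p).det = 1 := by
  have hp' : (p.2 : ℂ) ≠ 0 := by exact_mod_cast hp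
  rw [Matrix.det_fin_two]
  simp [toHermitian]
  field_simp
  ring

/-- Positivity of `H` plays no part: only `H 0 0 ≠ 0` matters, and `H 0 0 = 0` would make the
determinant `-|H 1 0|² ≤ 0`. -/
lemma toHermitian_ofHermitian {H : Matrix (Fin 2) (Fin 2) ℂ} (hH : Hᴴ = H) (hdet : H.det = 1) :
    toHermitian (ofHermitian H) = H := by
  have h00 : starRingEnd ℂ (H 0 0) = H 0 0 := congrFun (congrFun hH 0) 0
  have h01 : starRingEnd ℂ (H 1 0) = H 0 1 := congrFun (congrFun hH 0) 1
  have hre : ((H 0 0).re : ℂ) = H 0 0 := conj_eq_iff_re.1 h00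
  rw [Matrix.det_fin_two, ← h01, mul_comm (starRingEnd ℂ (H 1 0)), mul_conj] at hdet
  have hne : H 0 0 ≠ 0 := by
    intro h0
    rw [h0, zero_mul, zero_sub] at hdet
    have : -normSq (H 1 0) = 1 := by exact_mod_cast hdet
    linarith [normSq_nonneg (H 1 0)]
  ext i j
  fin_cases i <;> fin_cases j <;>
    simp only [toHermitian, ofHermitian, Fin.zero_eta, Fin.mk_one, Fin.isValue, Matrix.of_apply,
      Matrix.cons_val', Matrix.cons_val_zero, Matrix.cons_val_fin_one, Matrix.cons_val_one,
      ofReal_div, ofReal_one, map_div₀, hre, h00, h01]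
  · field_simp
  · field_simp
  · field_simp
  · field_simp
    rw [← h01, mul_conj]
    linear_combination -hdet

lemma toHermitian_conj (p : ℂ × ℝ) :
    toHermitian (starRingEnd ℂ p.1, p.2) = (toHermitian p).map (starRingEnd ℂ) := by
  ext i j
  fin_cases i <;> fin_cases j <;> simp [toHermitian]

/-- The action of an isometry in the Minkowski model. -/
lemma toHermitian_isometry (P : Matrix.SpecialLinearGroup (Fin 2) ℂ) (c : Bool) {p : ℂ × ℝ}
    (hp : p.2 ≠ 0) : toHermitian (isometry P c p) =
      P.1 * toHermitian (if c then (starRingEnd ℂ p.1, p.2) else p) * P.1ᴴ := by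
  rw [isometry, toHermitian_ofHermitian]
  · simp only [Matrix.conjTranspose_mul, Matrix.conjTranspose_conjTranspose,
      isHermitian_toHermitian, Matrix.mul_assoc]
  · rw [Matrix.det_mul, Matrix.det_mul, Matrix.det_conjTranspose, P.2, det_toHermitian]
    · simp
    · split_ifs <;> exact hp

lemma wirt_conj_of_hasDerivAt {f : ℂ → ℂ} {f' z : ℂ} (hf : HasDerivAt f f' z) :
    wirt (fun v => starRingEnd ℂ (f v)) z = 0 := by
  have hd : DifferentiableAt ℝ f z := hf.differentiableAt.restrictScalars ℝ
  have h (v : ℂ) : fderiv ℝ (fun v => starRingEnd ℂ (f v)) z v = starRingEnd ℂ (f' * v) := by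
    rw [← fderiv_real_apply_of_hasDerivAt hf]
    exact fderiv_clm_comp (conjCLE : ℂ →L[ℝ] ℂ) hd v
  rw [wirt, h, h, map_mul, map_mul, conj_I, map_one]
  linear_combination (starRingEnd ℂ f' / 2) * I_sq

/-- If `N = K K*` with `K` holomorphic, then `∂N · N⁻¹ = dK · K⁻¹`. -/
lemma fluxForm_exp_of_frame {Y : ℂ → ℂ × ℝ} {t : ℂ} (hY : DifferentiableAt ℝ Y (exp t))
    (hw : (Y (exp t)).2 ≠ 0) {K : ℂ → Matrix (Fin 2) (Fin 2) ℂ} {K' : Matrix (Fin 2) (Fin 2) ℂ}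
    (hK : ∀ i j, HasDerivAt (fun s => K s i j) (K' i j) t) (hdet : (K t).det = 1)
    (hYK : ∀ᶠ s in 𝓝 t, toHermitian (Y (exp s)) = K s * (K s)ᴴ) :
    exp t • fluxForm Y (exp t) = K' * (K t).adjugate := by
  rw [← fluxForm_comp hY hw (hasDerivAt_exp t), fluxForm, hYK.self_of_nhds,
    Matrix.adjugate_mul_distrib, ← Matrix.mul_assoc]
  congr 1
  -- `K*` is antiholomorphic, so `∂` treats it as a constant: `∂(K K*) = K' K*`, and `K*` then
  -- cancels in `∂N · N⁻¹`.
  have : Matrix.of (fun i j => wirt (fun v => toHermitian (Y (exp v)) i j) t) = K' * (K t)ᴴ := by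
    ext i j
    rw [Matrix.of_apply, wirt_congr (g := fun v => K v i 0 * starRingEnd ℂ (K v j 0) +
      K v i 1 * starRingEnd ℂ (K v j 1))]
    · have d := fun i j => ((hK i j).differentiableAt.restrictScalars ℝ)
      have d' := fun i j => differentiableAt_conj (d i j)
      rw [wirt_add ((d i 0).fun_mul (d' j 0)) ((d i 1).fun_mul (d' j 1)), wirt_mul (d i 0) (d' j 0),
        wirt_mul (d i 1) (d' j 1), wirt_conj_of_hasDerivAt (hK j 0), wirt_conj_of_hasDerivAt (hK j 1),
        wirt_of_hasDerivAt (hK i 0), wirt_of_hasDerivAt (hK i 1)]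
      simp [Matrix.mul_apply]
    · filter_upwards [hYK] with v hv
      rw [hv]
      simp [Matrix.mul_apply]
  rw [this, Matrix.mul_assoc, Matrix.mul_adjugate, Matrix.det_conjTranspose, hdet]
  simp

/-- A frame `F` of an end over the universal cover `exp` of the punctured disc of radius `r`, and
the expression `G z / z²` of the form `dF F⁻¹` in the disc, with residue `R`. -/
structure HasFluxFrame (R : Matrix (Fin 2) (Fin 2) ℂ) (r : ℝ)
    (F G : ℂ → Matrix (Fin 2) (Fin 2) ℂ) : Prop where
  holomorphic : ∀ i j, DifferentiableOn ℂ (fun z => G z i j) (Metric.ball 0 r)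
  deriv_zero : ∀ i j, deriv (fun z => G z i j) 0 = R i j
  det_eq_one : ∀ t : ℂ, exp t ∈ Metric.ball (0 : ℂ) r → (F t).det = 1
  hasDerivAt : ∀ t : ℂ, exp t ∈ Metric.ball (0 : ℂ) r → ∃ F' : Matrix (Fin 2) (Fin 2) ℂ,
    (∀ i j, HasDerivAt (fun s => F s i j) (F' i j) t) ∧ exp t • (F' * (F t).adjugate) = G (exp t)

/-- Needed for indirect isometries: conjugating both the variable and the values turns a holomorphic
frame into a holomorphic frame. -/
lemma HasFluxFrame.conj {R : Matrix (Fin 2) (Fin 2) ℂ} {r : ℝ} {F G : ℂ → Matrix (Fin 2) (Fin 2) ℂ}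
    (h : HasFluxFrame R r F G) :
    HasFluxFrame (R.map (starRingEnd ℂ)) r (fun t => (F (starRingEnd ℂ t)).map (starRingEnd ℂ))
      (fun z => (G (starRingEnd ℂ z)).map (starRingEnd ℂ)) where
  holomorphic i j z hz := by
    have hz' : starRingEnd ℂ z ∈ Metric.ball (0 : ℂ) r := by simpa using hz
    have := ((h.holomorphic i j).differentiableAt (Metric.isOpen_ball.mem_nhds hz')).hasDerivAt.conj_conj
    rw [conj_conj] at this
    exact this.differentiableAt.differentiableWithinAt
  deriv_zero i j := by
    have := congrFun (deriv_conj_conj (𝕜 := ℂ) (f := fun z => G z i j)) 0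
    rw [Function.comp_apply, Function.comp_apply, map_zero, h.deriv_zero i j] at this
    exact this
  det_eq_one t ht := by
    have ht' : exp (starRingEnd ℂ t) ∈ Metric.ball (0 : ℂ) r := by rw [exp_conj]; simpa using ht
    have := h.det_eq_one _ ht'
    change ((starRingEnd ℂ).mapMatrix _).det = 1
    rw [← RingHom.map_det, this, map_one]
  hasDerivAt t ht := by
    have ht' : exp (starRingEnd ℂ t) ∈ Metric.ball (0 : ℂ) r := by rw [exp_conj]; simpa using ht
    obtain ⟨F', hF', hG⟩ := h.hasDerivAt _ ht'
    refine ⟨F'.map (starRingEnd ℂ), fun i j => ?_, ?_⟩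
    · have := (hF' i j).conj_conj
      rw [conj_conj] at this
      exact this
    · rw [← exp_conj, ← hG]
      have := RingHom.map_adjugate (starRingEnd ℂ) (F (starRingEnd ℂ t))
      simp only [RingHom.mapMatrix_apply] at this
      rw [← this]
      ext i j
      simp [← exp_conj, Matrix.mul_apply]

/-- The flux form of an end whose image by an isometry has a frame. -/
lemma fluxForm_of_hasFluxFrame {R : Matrix (Fin 2) (Fin 2) ℂ} {r : ℝ}
    {F G : ℂ → Matrix (Fin 2) (Fin 2) ℂ} (h : HasFluxFrame R r F G) {Q : Matrix (Fin 2) (Fin 2) ℂ}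
    (hQ : Q.det = 1) {Y : ℂ → ℂ × ℝ} (hY : ∀ z ∈ puncturedDisc r, DifferentiableAt ℝ Y z)
    (hw : ∀ z ∈ puncturedDisc r, (Y z).2 ≠ 0)
    (hYF : ∀ t : ℂ, exp t ∈ puncturedDisc r → Q * toHermitian (Y (exp t)) * Qᴴ = F t * (F t)ᴴ)
    {z : ℂ} (hz : z ∈ puncturedDisc r) (i j : Fin 2) :
    fluxForm Y z i j = (Q.adjugate * G z * Q) i j / z ^ 2 := by
  obtain ⟨t, rfl⟩ : ∃ t, exp t = z := ⟨log z, exp_log hz.2⟩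
  obtain ⟨F', hF', hG⟩ := h.hasDerivAt t hz.1
  have hdet := h.det_eq_one t hz.1
  have hQQ : Q.adjugate * Q = 1 := by rw [Matrix.adjugate_mul, hQ, one_smul]
  have hQQ' : Qᴴ * Q.adjugateᴴ = 1 := by
    rw [← Matrix.conjTranspose_mul, hQQ, Matrix.conjTranspose_one]
  have hQa : Q.adjugate.adjugate = Q := by
    rw [Matrix.adjugate_adjugate _ (by simp)]; simp [hQ]
  -- The end itself has the frame `Q⁻¹ F`, and `d(Q⁻¹F)(Q⁻¹F)⁻¹ = Q⁻¹ (dF F⁻¹) Q`.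
  have key := fluxForm_exp_of_frame (Y := Y) (t := t) (hY _ hz) (hw _ hz)
    (K := fun s => Q.adjugate * F s) (K' := Q.adjugate * F') ?_ ?_ ?_
  · rw [Matrix.adjugate_mul_distrib, hQa] at key
    have h2 : exp t ^ 2 • fluxForm Y (exp t) = Q.adjugate * G (exp t) * Q := by
      rw [pow_two, mul_smul, key, ← hG]
      simp only [Matrix.mul_smul, Matrix.smul_mul, Matrix.mul_assoc]
    rw [← h2, Matrix.smul_apply, smul_eq_mul]
    field_simp [exp_ne_zero t]
  · intro i j
    simp only [Matrix.mul_apply, Fin.sum_univ_two]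
    exact ((hF' 0 j).const_mul _).add ((hF' 1 j).const_mul _)
  · rw [Matrix.det_mul, hdet, Matrix.det_adjugate, hQ]; simp
  · filter_upwards [((isOpen_puncturedDisc r).preimage continuous_exp).mem_nhds hz] with s hs
    rw [Matrix.conjTranspose_mul, Matrix.mul_assoc, ← Matrix.mul_assoc (F s), ← hYF s hs]
    simp only [Matrix.mul_assoc, hQQ', Matrix.mul_one]
    rw [← Matrix.mul_assoc, hQQ, Matrix.one_mul]

end

/-! ### The residue of a canonical catenoidal end. -/

section

open Complex

lemma exp_eq_one_of_eq_zero {a : ℂ} (h : a = 0) : exp a = 1 := by rw [h, exp_zero]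

lemma hasDerivAt_exp_mul_comp_exp {f : ℂ → ℂ} {t : ℂ} (hf : DifferentiableAt ℂ f (exp t)) (k a : ℂ) :
    HasDerivAt (fun s => k * exp (a * s) * f (exp s))
      (k * exp (a * t) * (a * f (exp t) + exp t * deriv f (exp t))) t := by
  have h1 : HasDerivAt (fun s => exp (a * s)) (exp (a * t) * a) t := by
    have := (hasDerivAt_id t).const_mul a
    simpa using this.cexp
  have h2 := hf.hasDerivAt.comp t (hasDerivAt_exp t)
  refine ((h1.const_mul k).mul h2).congr_deriv ?_
  simp only [Function.comp_apply]
  ring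

/-- The expression `a f + z f'`, where `z^a f` has derivative `z^(a-1) (a f + z f')`. -/
def eulerOp (a : ℂ) (f : ℂ → ℂ) (z : ℂ) : ℂ := a * f z + z * deriv f z

section eulerOp

variable {f : ℂ → ℂ} {r : ℝ}

lemma differentiableOn_eulerOp (hf : DifferentiableOn ℂ f (Metric.ball 0 r)) (a : ℂ) :
    DifferentiableOn ℂ (eulerOp a f) (Metric.ball 0 r) :=
  (hf.const_mul a).add (differentiableOn_id.mul (hf.deriv Metric.isOpen_ball))

lemma hasDerivAt_eulerOp (hf : DifferentiableOn ℂ f (Metric.ball 0 r)) (hr : 0 < r) (a : ℂ) :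
    HasDerivAt (eulerOp a f) ((a + 1) * deriv f 0) 0 := by
  have hb : Metric.ball (0 : ℂ) r ∈ 𝓝 (0 : ℂ) := Metric.ball_mem_nhds 0 hr
  have h1 := (hf.differentiableAt hb).hasDerivAt
  have h2 := ((hf.deriv Metric.isOpen_ball).differentiableAt hb).hasDerivAt
  refine ((h1.const_mul a).add ((hasDerivAt_id (0 : ℂ)).mul h2)).congr_deriv ?_
  simp
  ring

lemma eulerOp_zero (a : ℂ) (f : ℂ → ℂ) : eulerOp a f 0 = a * f 0 := by simp [eulerOp]

end eulerOp

/-- The coefficient of the flux form of a canonical catenoidal end. -/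
def canonicalFlux (μ : ℝ) (f₁ f₂ g₁ g₂ : ℂ → ℂ) (z : ℂ) : Matrix (Fin 2) (Fin 2) ℂ :=
  let b : ℂ := (μ - 1) / (μ + 1)
  let c : ℂ := (μ ^ 2 - 1) / (4 * μ)
  let d : ℂ := (1 + μ) ^ 2 / (4 * μ)
  !![z * (d * eulerOp ((1 - μ) / 2) f₂ z * g₁ z - b * c * eulerOp ((1 + μ) / 2) g₂ z * f₁ z),
      z * z * (b * (eulerOp ((1 + μ) / 2) g₂ z * f₂ z - eulerOp ((1 - μ) / 2) f₂ z * g₂ z));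
    c * d * (eulerOp ((-1 - μ) / 2) f₁ z * g₁ z - eulerOp ((μ - 1) / 2) g₁ z * f₁ z),
      z * (d * eulerOp ((μ - 1) / 2) g₁ z * f₂ z - b * c * eulerOp ((-1 - μ) / 2) f₁ z * g₂ z)]

/-- The upper right entry is `O(z²)`, so it has no pole. The lower left one has a double pole, whose
residue is a combination of `f₁'(0)` and `g₁'(0)`. The diagonal gives `±(1 - μ²)/4` from the values
at `0` alone. -/
lemma deriv_canonicalFlux {μ r : ℝ} (hμ : 0 < μ) (hr : 0 < r) {f₁ f₂ g₁ g₂ : ℂ → ℂ}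
    (hf₁ : DifferentiableOn ℂ f₁ (Metric.ball 0 r)) (hf₂ : DifferentiableOn ℂ f₂ (Metric.ball 0 r))
    (hg₁ : DifferentiableOn ℂ g₁ (Metric.ball 0 r)) (hg₂ : DifferentiableOn ℂ g₂ (Metric.ball 0 r))
    (f10 : f₁ 0 = 1) (f20 : f₂ 0 = 1) (g10 : g₁ 0 = 1) (g20 : g₂ 0 = 1)
    (df1 : deriv f₁ 0 = 0) (dg1 : deriv g₁ 0 = 0) (i j : Fin 2) :
    deriv (fun z => canonicalFlux μ f₁ f₂ g₁ g₂ z i j) 0 =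
      (((1 - (μ : ℂ) ^ 2) / 4) • !![1, 0; 0, -1] : Matrix (Fin 2) (Fin 2) ℂ) i j := by
  have hμ' : (μ : ℂ) ≠ 0 := by exact_mod_cast hμ.ne'
  have hμp' : ((μ : ℂ) + 1) ≠ 0 := by
    have : (μ + 1) ≠ 0 := by positivity
    exact_mod_cast this
  have hb : Metric.ball (0 : ℂ) r ∈ 𝓝 (0 : ℂ) := Metric.ball_mem_nhds 0 hr
  have k1 := hasDerivAt_eulerOp hf₂ hr ((1 - μ) / 2)
  have k2 := hasDerivAt_eulerOp hg₂ hr ((1 + μ) / 2)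
  have k3 := hasDerivAt_eulerOp hf₁ hr ((-1 - μ) / 2)
  have k4 := hasDerivAt_eulerOp hg₁ hr ((μ - 1) / 2)
  have l1 := (hf₁.differentiableAt hb).hasDerivAt
  have l2 := (hf₂.differentiableAt hb).hasDerivAt
  have l3 := (hg₁.differentiableAt hb).hasDerivAt
  have l4 := (hg₂.differentiableAt hb).hasDerivAt
  have hid := hasDerivAt_id (0 : ℂ)
  fin_cases i <;> fin_cases j
  · have := hid.mul (((k1.const_mul ((1 + (μ : ℂ)) ^ 2 / (4 * μ))).mul l3).sub
      ((k2.const_mul (((μ : ℂ) - 1) / (μ + 1) * ((μ ^ 2 - 1) / (4 * μ)))).mul l1))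
    refine Eq.trans (HasDerivAt.deriv this) ?_
    simp [eulerOp_zero, f10, f20, g10, g20]
    field_simp
    ring
  · have := (hid.mul hid).mul (((k2.mul l2).sub (k1.mul l4)).const_mul (((μ : ℂ) - 1) / (μ + 1)))
    refine Eq.trans (HasDerivAt.deriv this) ?_
    simp
  · have := ((k3.mul l3).sub (k4.mul l1)).const_mul
      (((μ : ℂ) ^ 2 - 1) / (4 * μ) * ((1 + μ) ^ 2 / (4 * μ)))
    refine Eq.trans (HasDerivAt.deriv this) ?_
    simp [df1, dg1]
  · have := hid.mul (((k4.const_mul ((1 + (μ : ℂ)) ^ 2 / (4 * μ))).mul l2).sub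
      ((k3.const_mul (((μ : ℂ) - 1) / (μ + 1) * ((μ ^ 2 - 1) / (4 * μ)))).mul l4))
    refine Eq.trans (HasDerivAt.deriv this) ?_
    simp [eulerOp_zero, f10, f20, g10, g20]
    field_simp
    ring

/-- The derivative of `canonicalFrame`. -/
def canonicalFrameDeriv (μ : ℝ) (f₁ f₂ g₁ g₂ : ℂ → ℂ) (t : ℂ) : Matrix (Fin 2) (Fin 2) ℂ :=
  !![exp ((1 - μ) / 2 * t) * eulerOp ((1 - μ) / 2) f₂ (exp t),
      (μ - 1) / (μ + 1) * exp ((1 + μ) / 2 * t) * eulerOp ((1 + μ) / 2) g₂ (exp t);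
      (μ ^ 2 - 1) / (4 * μ) * exp ((-1 - μ) / 2 * t) * eulerOp ((-1 - μ) / 2) f₁ (exp t),
      (1 + μ) ^ 2 / (4 * μ) * exp ((μ - 1) / 2 * t) * eulerOp ((μ - 1) / 2) g₁ (exp t)]

/-- `F' F⁻¹` is the coefficient of `dt = dz/z`, so one more factor `z` yields `z²` times the
coefficient of `dz`. In every entry the fractional powers of `z` combine to an integral one, which
makes the result single-valued. -/
lemma exp_smul_canonicalFrameDeriv_mul (μ : ℝ) (f₁ f₂ g₁ g₂ : ℂ → ℂ) (t : ℂ) :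
    exp t • (canonicalFrameDeriv μ f₁ f₂ g₁ g₂ t * (canonicalFrame μ f₁ f₂ g₁ g₂ t).adjugate) =
      canonicalFlux μ f₁ f₂ g₁ g₂ (exp t) := by
  have x1 : exp ((1 - μ) / 2 * t) * exp ((μ - 1) / 2 * t) = 1 := by
    rw [← exp_add, exp_eq_one_of_eq_zero]; ring
  have x2 : exp ((1 + μ) / 2 * t) * exp ((-1 - μ) / 2 * t) = 1 := by
    rw [← exp_add, exp_eq_one_of_eq_zero]; ring
  have x3 : exp ((1 - μ) / 2 * t) * exp ((1 + μ) / 2 * t) = exp t := by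
    rw [← exp_add]; congr 1; ring
  have x4 : exp t * (exp ((-1 - μ) / 2 * t) * exp ((μ - 1) / 2 * t)) = 1 := by
    rw [← exp_add, ← exp_add, exp_eq_one_of_eq_zero]; ring
  rw [Matrix.adjugate_fin_two]
  ext i j
  fin_cases i <;> fin_cases j <;>
    simp only [canonicalFrame, canonicalFrameDeriv, canonicalFlux, Fin.zero_eta, Fin.mk_one, Fin.isValue,
      Matrix.smul_apply, Matrix.mul_apply, Fin.sum_univ_two, Matrix.of_apply, Matrix.cons_val',
      Matrix.cons_val_zero, Matrix.cons_val_fin_one, Matrix.cons_val_one, smul_eq_mul]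
  · linear_combination exp t * (1 + (μ : ℂ)) ^ 2 / (4 * μ) *
      eulerOp ((1 - μ) / 2) f₂ (exp t) * g₁ (exp t) * x1 - exp t * ((μ - 1) / (μ + 1)) *
      ((μ ^ 2 - 1) / (4 * μ)) * eulerOp ((1 + μ) / 2) g₂ (exp t) * f₁ (exp t) * x2
  · linear_combination exp t * ((μ : ℂ) - 1) / (μ + 1) * (eulerOp ((1 + μ) / 2) g₂ (exp t) *
      f₂ (exp t) - eulerOp ((1 - μ) / 2) f₂ (exp t) * g₂ (exp t)) * x3
  · linear_combination ((μ : ℂ) ^ 2 - 1) / (4 * μ) * ((1 + μ) ^ 2 / (4 * μ)) *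
      (eulerOp ((-1 - μ) / 2) f₁ (exp t) * g₁ (exp t) -
        eulerOp ((μ - 1) / 2) g₁ (exp t) * f₁ (exp t)) * x4
  · linear_combination exp t * (1 + (μ : ℂ)) ^ 2 / (4 * μ) *
      eulerOp ((μ - 1) / 2) g₁ (exp t) * f₂ (exp t) * x1 - exp t * ((μ - 1) / (μ + 1)) *
      ((μ ^ 2 - 1) / (4 * μ)) * eulerOp ((-1 - μ) / 2) f₁ (exp t) * g₂ (exp t) * x2

/-- The residue of the flux form of a canonical catenoidal end. -/
lemma IsCanonicalCatenoidalEnd.exists_hasFluxFrame {μ : ℝ} {r : ℝ} {Y : ℂ → ℂ × ℝ}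
    (h : IsCanonicalCatenoidalEnd μ 0 r Y) :
    ∃ F G, HasFluxFrame (((1 - (μ : ℂ) ^ 2) / 4) • !![1, 0; 0, -1]) r F G ∧
      ∀ t : ℂ, exp t ∈ Metric.ball (0 : ℂ) r → Y (exp t) = ofHermitian (F t * (F t)ᴴ) := by
  obtain ⟨hμ, hμ1, hr, f₁, f₂, g₁, g₂, h, hf₁, hf₂, hg₁, hg₂, -, f10, f20, g10, g20, hZ, hF⟩ := h
  have hμ' : (μ : ℂ) ≠ 0 := by exact_mod_cast hμ.ne'
  have hμp : (1 + (μ : ℂ)) ≠ 0 := by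
    have : (1 + μ) ≠ 0 := by positivity
    exact_mod_cast this
  have hμp' : ((μ : ℂ) + 1) ≠ 0 := by rwa [add_comm]
  have hμm : ((μ : ℂ) ^ 2 - 1) ≠ 0 := by
    have : (μ : ℂ) - 1 ≠ 0 := by
      rw [sub_ne_zero]; exact_mod_cast hμ1
    have h2 := mul_ne_zero this hμp'
    intro h0
    exact h2 (by linear_combination h0)
  have hb : Metric.ball (0 : ℂ) r ∈ 𝓝 (0 : ℂ) := Metric.ball_mem_nhds 0 hr
  -- The finite end of the axis is `0 = (μ² - 1)/(4μ) · f₁'(0)`, and the factor is nonzero because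
  -- `μ ≠ 1`.
  have df1 : deriv f₁ 0 = 0 := by
    rcases mul_eq_zero.1 hZ.symm with h0 | h0
    · exact absurd h0 (div_ne_zero hμm (mul_ne_zero (by norm_num) hμ'))
    · exact h0
  have hD : ∀ (f : ℂ → ℂ), DifferentiableOn ℂ f (Metric.ball 0 r) → ∀ t : ℂ,
      exp t ∈ Metric.ball (0 : ℂ) r → DifferentiableAt ℂ f (exp t) := fun f hf t ht =>
    hf.differentiableAt (Metric.isOpen_ball.mem_nhds ht)
  have hC' : ∀ t : ℂ, exp t ∈ Metric.ball (0 : ℂ) r → HasDerivAt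
      (fun s => canonicalFrame μ f₁ f₂ g₁ g₂ s 1 0) ((μ ^ 2 - 1) / (4 * μ) *
        exp ((-1 - μ) / 2 * t) * eulerOp ((-1 - μ) / 2) f₁ (exp t)) t := fun t ht =>
    hasDerivAt_exp_mul_comp_exp (hD f₁ hf₁ t ht) _ _
  have hD' : ∀ t : ℂ, exp t ∈ Metric.ball (0 : ℂ) r → HasDerivAt
      (fun s => canonicalFrame μ f₁ f₂ g₁ g₂ s 1 1) ((1 + μ) ^ 2 / (4 * μ) *
        exp ((μ - 1) / 2 * t) * eulerOp ((μ - 1) / 2) g₁ (exp t)) t := fun t ht =>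
    hasDerivAt_exp_mul_comp_exp (hD g₁ hg₁ t ht) _ _
  have hA' : ∀ t : ℂ, exp t ∈ Metric.ball (0 : ℂ) r → HasDerivAt
      (fun s => canonicalFrame μ f₁ f₂ g₁ g₂ s 0 0) (
        exp ((1 - μ) / 2 * t) * eulerOp ((1 - μ) / 2) f₂ (exp t)) t := fun t ht => by
    have := hasDerivAt_exp_mul_comp_exp (hD f₂ hf₂ t ht) 1 ((1 - μ) / 2)
    simp only [one_mul] at this
    exact this
  have hB' : ∀ t : ℂ, exp t ∈ Metric.ball (0 : ℂ) r → HasDerivAt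
      (fun s => canonicalFrame μ f₁ f₂ g₁ g₂ s 0 1) ((μ - 1) / (μ + 1) *
        exp ((1 + μ) / 2 * t) * eulerOp ((1 + μ) / 2) g₂ (exp t)) t := fun t ht =>
    hasDerivAt_exp_mul_comp_exp (hD g₂ hg₂ t ht) _ _
  -- The second row of `F⁻¹dF` gives `dD = -g dC`. With `g = z^μ`, both sides carry the same power
  -- `z^((μ-1)/2)`, which is cancelled.
  have hrel : ∀ z ∈ puncturedDisc r, (1 + (μ : ℂ)) ^ 2 / (4 * μ) * eulerOp ((μ - 1) / 2) g₁ z =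
      -((μ ^ 2 - 1) / (4 * μ) * eulerOp ((-1 - μ) / 2) f₁ z) := by
    intro z hz
    obtain ⟨t, rfl⟩ : ∃ t, exp t = z := ⟨log z, exp_log hz.2⟩
    have e1 := (hC' t hz.1).unique ((hF t hz.1).2.1 1 0)
    have e2 := (hD' t hz.1).unique ((hF t hz.1).2.1 1 1)
    have e3 : exp ((μ - 1) / 2 * t) = exp (μ * t) * exp ((-1 - μ) / 2 * t) := by
      rw [← exp_add]; congr 1; ring
    simp only [Matrix.mul_apply, Fin.sum_univ_two, weierstrassMatrix, Matrix.smul_apply,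
      Matrix.of_apply, Matrix.cons_val', Matrix.cons_val_zero, Matrix.cons_val_fin_one,
      Matrix.cons_val_one, smul_eq_mul, mul_one] at e1 e2
    refine mul_left_cancel₀ (exp_ne_zero ((μ - 1) / 2 * t)) ?_
    have e4 : ∀ u : ℂ, exp ((μ - 1) / 2 * t) * u = exp (μ * t) * (exp ((-1 - μ) / 2 * t) * u) := by
      intro u; rw [e3]; ring
    rw [mul_neg, e4 ((μ ^ 2 - 1) / (4 * μ) * _)]
    linear_combination e2 + exp (μ * t) * e1
  -- The relation extends to `z = 0`; differentiated there, it makes `g₁'(0)` a multiple of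
  -- `f₁'(0)`, after division by a factor that is nonzero since `μ > 0`.
  have dg1 : deriv g₁ 0 = 0 := by
    have h1 := (hasDerivAt_eulerOp hg₁ hr ((μ - 1) / 2)).const_mul ((1 + (μ : ℂ)) ^ 2 / (4 * μ))
    have h2 := ((hasDerivAt_eulerOp hf₁ hr ((-1 - μ) / 2)).const_mul
      (((μ : ℂ) ^ 2 - 1) / (4 * μ))).neg
    have hev : (fun z => (1 + (μ : ℂ)) ^ 2 / (4 * μ) * eulerOp ((μ - 1) / 2) g₁ z) =ᶠ[𝓝 0]
        -(fun z => ((μ : ℂ) ^ 2 - 1) / (4 * μ) * eulerOp ((-1 - μ) / 2) f₁ z) := by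
      filter_upwards [hb] with z hz
      by_cases hz0 : z = 0
      · subst hz0
        simp only [Pi.neg_apply, eulerOp_zero, f10, g10]
        field_simp
        ring
      · exact hrel z ⟨hz, hz0⟩
    have := h1.unique (h2.congr_of_eventuallyEq hev)
    rw [df1, mul_zero, mul_zero, neg_zero] at this
    have hne : (1 + (μ : ℂ)) ^ 2 / (4 * μ) * ((μ - 1) / 2 + 1) ≠ 0 := by
      have : ((μ : ℂ) - 1) / 2 + 1 = (1 + μ) / 2 := by ring
      rw [this]
      have h4 : (4 : ℂ) * μ ≠ 0 := mul_ne_zero (by norm_num) hμ'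
      exact mul_ne_zero (div_ne_zero (pow_ne_zero 2 hμp) h4) (div_ne_zero hμp two_ne_zero)
    rw [← mul_assoc] at this
    exact (mul_eq_zero.1 this).resolve_left hne
  refine ⟨canonicalFrame μ f₁ f₂ g₁ g₂, canonicalFlux μ f₁ f₂ g₁ g₂, ⟨?_, ?_, ?_, ?_⟩, fun t ht =>
    (hF t ht).2.2⟩
  · intro i j
    have k1 := differentiableOn_eulerOp hf₂ ((1 - μ) / 2)
    have k2 := differentiableOn_eulerOp hg₂ ((1 + μ) / 2)
    have k3 := differentiableOn_eulerOp hf₁ ((-1 - μ) / 2)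
    have k4 := differentiableOn_eulerOp hg₁ ((μ - 1) / 2)
    fin_cases i <;> fin_cases j <;> simp [canonicalFlux] <;> fun_prop
  · exact deriv_canonicalFlux hμ hr hf₁ hf₂ hg₁ hg₂ f10 f20 g10 g20 df1 dg1
  · exact fun t ht => (hF t ht).1
  · intro t ht
    refine ⟨canonicalFrameDeriv μ f₁ f₂ g₁ g₂ t, ?_, exp_smul_canonicalFrameDeriv_mul μ f₁ f₂ g₁ g₂ t⟩
    intro i j
    fin_cases i <;> fin_cases j
    exacts [hA' t ht, hB' t ht, hC' t ht, hD' t ht]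

end

/-! ### The axis of an end as the eigenlines of its flux. -/

section

open Complex

/-- Homogeneous coordinates of a point of the Riemann sphere. -/
def homCoords : OnePoint ℂ → Fin 2 → ℂ
  | none => ![0, 1]
  | some ζ => ![1, ζ]

/-- A nonzero linear form on `ℂ²` vanishes on exactly one line, and a line is one point of the
sphere. -/
lemma homCoords_injective_of_linear {a b : ℂ} (hab : a ≠ 0 ∨ b ≠ 0) {x y : OnePoint ℂ}
    (hx : a * homCoords x 0 + b * homCoords x 1 = 0)
    (hy : a * homCoords y 0 + b * homCoords y 1 = 0) : x = y := by
  rcases x with _ | x <;> rcases y with _ | y <;> simp [homCoords] at hx hy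
  · rfl
  · simp_all
  · simp_all
  · have hb : b ≠ 0 := by
      rintro rfl
      simp_all
    have : x = y := mul_left_cancel₀ hb (by linear_combination hx - hy)
    rw [this]

lemma homCoords_map_conj (x : OnePoint ℂ) (i : Fin 2) :
    homCoords (OnePoint.map (starRingEnd ℂ) x) i = starRingEnd ℂ (homCoords x i) := by
  rcases x with _ | x
  · change ![(0 : ℂ), 1] i = starRingEnd ℂ (![(0 : ℂ), 1] i)
    fin_cases i <;> simp
  · change ![(1 : ℂ), starRingEnd ℂ x] i = starRingEnd ℂ (![(1 : ℂ), x] i)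
    fin_cases i <;> simp

/-- `P` acts on the column `(1, ζ)`, with `∞` as `(0, 1)`. A point is sent to `0` when the second
coordinate of its image vanishes, and to `∞` when the first one does. -/
lemma moebius_eq_zero {P : Matrix.SpecialLinearGroup (Fin 2) ℂ} {x : OnePoint ℂ}
    (h : moebius P x = ((0 : ℂ) : OnePoint ℂ)) :
    P.1 1 0 * homCoords x 0 + P.1 1 1 * homCoords x 1 = 0 := by
  rcases x with _ | x <;> simp only [moebius] at h <;> split_ifs at h with h0
  · exact absurd h (OnePoint.infty_ne_coe _)
  · have := OnePoint.coe_injective h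
    simpa [homCoords, h0] using this
  · exact absurd h (OnePoint.infty_ne_coe _)
  · have := (div_eq_zero_iff.1 (OnePoint.coe_injective h)).resolve_right h0
    simp [homCoords]
    linear_combination this

lemma moebius_eq_infty {P : Matrix.SpecialLinearGroup (Fin 2) ℂ} {x : OnePoint ℂ}
    (h : moebius P x = OnePoint.infty) :
    P.1 0 0 * homCoords x 0 + P.1 0 1 * homCoords x 1 = 0 := by
  rcases x with _ | x <;> simp only [moebius] at h <;> split_ifs at h with h0
  · simpa [homCoords] using h0
  · exact absurd h (OnePoint.coe_ne_infty _)
  · simp [homCoords]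
    linear_combination h0
  · exact absurd h (OnePoint.coe_ne_infty _)

/-- The matrix of the linear part of the isometry `isometry P c`. -/
def linearPart (P : Matrix.SpecialLinearGroup (Fin 2) ℂ) (c : Bool) : Matrix (Fin 2) (Fin 2) ℂ :=
  if c then P.1.map (starRingEnd ℂ) else P.1

lemma det_linearPart (P : Matrix.SpecialLinearGroup (Fin 2) ℂ) (c : Bool) :
    (linearPart P c).det = 1 := by
  cases c
  · exact P.2
  · change ((starRingEnd ℂ).mapMatrix P.1).det = 1
    rw [← RingHom.map_det, P.2, map_one]

lemma boundaryMap_eq_zero {P : Matrix.SpecialLinearGroup (Fin 2) ℂ} {c : Bool} {x : OnePoint ℂ}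
    (h : boundaryMap P c x = ((0 : ℂ) : OnePoint ℂ)) :
    linearPart P c 1 0 * homCoords x 0 + linearPart P c 1 1 * homCoords x 1 = 0 := by
  have := moebius_eq_zero h
  cases c
  · exact this
  · simp only [if_true, homCoords_map_conj] at this
    have h2 := congrArg (starRingEnd ℂ) this
    simpa [linearPart] using h2

lemma boundaryMap_eq_infty {P : Matrix.SpecialLinearGroup (Fin 2) ℂ} {c : Bool} {x : OnePoint ℂ}
    (h : boundaryMap P c x = OnePoint.infty) :
    linearPart P c 0 0 * homCoords x 0 + linearPart P c 0 1 * homCoords x 1 = 0 := by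
  have := moebius_eq_infty h
  cases c
  · exact this
  · simp only [if_true, homCoords_map_conj] at this
    have h2 := congrArg (starRingEnd ℂ) this
    simpa [linearPart] using h2

/-- The matrix with eigenvalues `1`, `-1` whose eigenlines are mapped by `Q` to `0`, `∞`. -/
def fluxMatrix (Q : Matrix (Fin 2) (Fin 2) ℂ) : Matrix (Fin 2) (Fin 2) ℂ :=
  Q.adjugate * !![1, 0; 0, -1] * Q

variable {M : Type*} [TopologicalSpace M] [ChartedSpace ℂ M]

/-- The flux of a catenoidal end: its flux form has residue `(1 - μ²)/4 Q⁻¹ diag(1, -1) Q`, where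
`Q` maps the axis of the end to `(0, ∞)`. -/
lemma IsCatenoidalEnd.exists_residue [IsManifold 𝓘(ℂ) ω M] {X : M → UpperHalfSpace}
    (hX : IsBryantSurface X) {E : Set M} {μ : ℝ} {a b : OnePoint ℂ}
    (h : IsCatenoidalEnd X E μ a b) :
    0 < μ ∧ μ ≠ 1 ∧ ∃ (Q : Matrix (Fin 2) (Fin 2) ℂ) (r : ℝ) (φ : ℂ → M)
      (H : ℂ → Matrix (Fin 2) (Fin 2) ℂ), Q.det = 1 ∧
      Q 1 0 * homCoords a 0 + Q 1 1 * homCoords a 1 = 0 ∧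
      Q 0 0 * homCoords b 0 + Q 0 1 * homCoords b 1 = 0 ∧
      IsEndParametrization E r φ ∧
      ∀ i j, DifferentiableOn ℂ (fun z => H z i j) (Metric.ball 0 r) ∧
        deriv (fun z => H z i j) 0 =
          (1 - (μ : ℂ) ^ 2) / 4 * fluxMatrix Q i j ∧
        ∀ z ∈ puncturedDisc r, fluxForm (fun v => (X (φ v)).1) z i j = H z i j / z ^ 2 := by
  obtain ⟨-, P, c, ha, hb, r, φ, Y, hφ, hcan, hY⟩ := h
  obtain ⟨F, G, hFG, hYF⟩ := hcan.exists_hasFluxFrame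
  refine ⟨hcan.1, hcan.2.1, linearPart P c, r, φ, ?_⟩
  have hparam : IsParam φ (puncturedDisc r) :=
    isParam_of_mdifferentiableOn (isOpen_puncturedDisc _) hφ.holomorphic hφ.injOn
  have hdiff : ∀ z ∈ puncturedDisc r, DifferentiableAt ℝ (fun v => (X (φ v)).1) z := fun z hz =>
    differentiableAt_param hX hparam hz
  have hw : ∀ z ∈ puncturedDisc r, (X (φ z)).1.2 ≠ 0 := fun z _ => (X (φ z)).2.ne'
  have hframe : ∀ t : ℂ, exp t ∈ Metric.ball (0 : ℂ) r →
      toHermitian (Y (exp t)) = F t * (F t)ᴴ := by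
    intro t ht
    rw [hYF t ht, toHermitian_ofHermitian]
    · rw [Matrix.conjTranspose_mul, Matrix.conjTranspose_conjTranspose]
    · rw [Matrix.det_mul, Matrix.det_conjTranspose, hFG.det_eq_one t ht]; simp
  obtain ⟨F', G', hFG', hYF'⟩ : ∃ F' G', HasFluxFrame (((1 - (μ : ℂ) ^ 2) / 4) • !![1, 0; 0, -1]) r F' G' ∧
      ∀ t : ℂ, exp t ∈ puncturedDisc r →
        linearPart P c * toHermitian (X (φ (exp t))).1 * (linearPart P c)ᴴ = F' t * (F' t)ᴴ := by
    cases c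
    · refine ⟨F, G, hFG, fun t ht => ?_⟩
      have h1 := congrArg toHermitian (hY _ ht)
      rw [toHermitian_isometry P _ (hw _ ht)] at h1
      simp only [Bool.false_eq_true, if_false] at h1
      rw [hframe t ht.1] at h1
      exact h1
    -- For an indirect isometry the data give `P N̄ P* = F F*`, with the right side taken at the
    -- conjugate of `t`. Conjugating the whole equation leaves `N` itself, with the conjugate matrix
    -- of `P` and a frame that is again holomorphic in `t`.
    · refine ⟨fun t => (F (starRingEnd ℂ t)).map (starRingEnd ℂ),
        fun z => (G (starRingEnd ℂ z)).map (starRingEnd ℂ), ?_, fun t ht => ?_⟩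
      -- The residue is a real matrix, so conjugation does not change it.
      · have := hFG.conj
        convert this using 1
        have h4 : starRingEnd ℂ (4 : ℂ) = 4 := map_ofNat _ 4
        ext i j
        fin_cases i <;> fin_cases j <;> simp [h4]
      · have h1 := congrArg toHermitian (hY _ ht)
        rw [toHermitian_isometry P _ (hw _ ht)] at h1
        simp only [if_true] at h1
        have ht' : exp (starRingEnd ℂ t) ∈ Metric.ball (0 : ℂ) r := by
          rw [exp_conj]; simpa using ht.1
        rw [toHermitian_conj, ← exp_conj, hframe _ ht'] at h1
        have h2 := congrArg (starRingEnd ℂ).mapMatrix h1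
        rw [map_mul, map_mul, map_mul] at h2
        have hc : ∀ A : Matrix (Fin 2) (Fin 2) ℂ,
            (starRingEnd ℂ).mapMatrix Aᴴ = ((starRingEnd ℂ).mapMatrix A)ᴴ := fun A => by
          ext i j; simp
        rw [hc, hc] at h2
        have hcc : (starRingEnd ℂ).mapMatrix ((toHermitian (X (φ (exp t))).1).map (starRingEnd ℂ)) =
            toHermitian (X (φ (exp t))).1 := by
          ext i j; simp
        rw [hcc] at h2
        exact h2
  refine ⟨fun z => (linearPart P c).adjugate * G' z * linearPart P c, det_linearPart P c,
    boundaryMap_eq_zero ha, boundaryMap_eq_infty hb, hφ, fun i j => ⟨?_, ?_, fun z hz => ?_⟩⟩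
  · have := hFG'.holomorphic
    simp only [Matrix.mul_apply, Fin.sum_univ_two]
    fun_prop
  · have hd : ∀ k l, HasDerivAt (fun z => G' z k l)
        ((((1 - (μ : ℂ) ^ 2) / 4) • !![1, 0; 0, -1] : Matrix (Fin 2) (Fin 2) ℂ) k l) 0 := by
      intro k l
      rw [← hFG'.deriv_zero k l]
      exact ((hFG'.holomorphic k l).differentiableAt (Metric.ball_mem_nhds 0 hφ.pos)).hasDerivAt
    have : HasDerivAt (fun z => ((linearPart P c).adjugate * G' z * linearPart P c) i j)
        (((linearPart P c).adjugate * (((1 - (μ : ℂ) ^ 2) / 4) • !![1, 0; 0, -1] :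
          Matrix (Fin 2) (Fin 2) ℂ) * linearPart P c) i j) 0 := by
      simp only [Matrix.mul_apply, Fin.sum_univ_two]
      exact ((((hd 0 0).const_mul _).add ((hd 1 0).const_mul _)).mul_const _).add
        ((((hd 0 1).const_mul _).add ((hd 1 1).const_mul _)).mul_const _)
    rw [this.deriv, Matrix.mul_smul, Matrix.smul_mul, Matrix.smul_apply, smul_eq_mul, fluxMatrix]
  · exact fluxForm_of_hasFluxFrame hFG' (det_linearPart P c) hdiff hw hYF' hz i j

lemma row_ne_zero {Q : Matrix (Fin 2) (Fin 2) ℂ} (hQ : Q.det = 1) (i : Fin 2) :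
    Q i 0 ≠ 0 ∨ Q i 1 ≠ 0 := by
  by_contra! h
  rw [Matrix.det_fin_two] at hQ
  fin_cases i <;> simp_all

/-- Two opposite fluxes have the same axis, up to orientation. -/
lemma axes_eq_of_flux_add_eq_zero {Q₁ Q₂ : Matrix (Fin 2) (Fin 2) ℂ} (h₁ : Q₁.det = 1)
    (h₂ : Q₂.det = 1) {c₁ c₂ : ℂ} (hc₁ : c₁ ≠ 0)
    (hsum : ∀ i j, c₁ * fluxMatrix Q₁ i j +
      c₂ * fluxMatrix Q₂ i j = 0)
    {A₁ B₁ A₂ B₂ : OnePoint ℂ}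
    (hA₁ : Q₁ 1 0 * homCoords A₁ 0 + Q₁ 1 1 * homCoords A₁ 1 = 0)
    (hB₁ : Q₁ 0 0 * homCoords B₁ 0 + Q₁ 0 1 * homCoords B₁ 1 = 0)
    (hA₂ : Q₂ 1 0 * homCoords A₂ 0 + Q₂ 1 1 * homCoords A₂ 1 = 0)
    (hB₂ : Q₂ 0 0 * homCoords B₂ 0 + Q₂ 0 1 * homCoords B₂ 1 = 0) (hB : B₁ ≠ B₂) :
    c₁ = c₂ ∧ A₁ = B₂ ∧ A₂ = B₁ := by
  have hS : c₁ • fluxMatrix Q₁ + c₂ • fluxMatrix Q₂ = 0 := by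
    ext i j
    simpa using hsum i j
  -- On an eigenvector of the first flux the relation `c₁ S₁ + c₂ S₂ = 0` becomes diagonal once `Q₂`
  -- is applied, and its two coordinates separate.
  have key : ∀ v : Fin 2 → ℂ, ∀ ε : ℂ, fluxMatrix Q₁ *ᵥ v = ε • v →
      (c₁ * ε + c₂) * (Q₂ 0 0 * v 0 + Q₂ 0 1 * v 1) = 0 ∧
      (c₁ * ε - c₂) * (Q₂ 1 0 * v 0 + Q₂ 1 1 * v 1) = 0 := by
    intro v ε hv
    have h3 := congrArg (fun S => Q₂ *ᵥ (S *ᵥ v)) hS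
    simp only [Matrix.add_mulVec, Matrix.smul_mulVec, hv, Matrix.zero_mulVec, Matrix.mulVec_add,
      Matrix.mulVec_smul, Matrix.mulVec_zero, Matrix.mulVec_mulVec] at h3
    rw [fluxMatrix, ← Matrix.mul_assoc, ← Matrix.mul_assoc, Matrix.mul_adjugate, h₂, one_smul,
      Matrix.one_mul, ← Matrix.mulVec_mulVec] at h3
    have k0 := congrFun h3 0
    have k1 := congrFun h3 1
    simp at k0 k1
    exact ⟨by linear_combination k0, by linear_combination k1⟩
  have eig : ∀ v : Fin 2 → ℂ, ∀ ε : ℂ, !![1, 0; 0, -1] *ᵥ (Q₁ *ᵥ v) = ε • (Q₁ *ᵥ v) →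
      fluxMatrix Q₁ *ᵥ v = ε • v := by
    intro v ε hv
    rw [fluxMatrix, ← Matrix.mulVec_mulVec, ← Matrix.mulVec_mulVec, hv, Matrix.mulVec_smul,
      Matrix.mulVec_mulVec, Matrix.adjugate_mul, h₁, one_smul, Matrix.one_mulVec]
  have eA := key _ 1 (eig (homCoords A₁) 1 (by
    ext i
    fin_cases i <;> simp [Matrix.mulVec, dotProduct, Fin.sum_univ_two, hA₁]))
  have eB := key _ (-1) (eig (homCoords B₁) (-1) (by
    ext i
    fin_cases i <;> simp [Matrix.mulVec, dotProduct, Fin.sum_univ_two, hB₁]))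
  -- Otherwise the first coordinate of `Q₂` on the line `B₁` would vanish, which characterizes `B₂`;
  -- this is where `B₁ ≠ B₂` is used.
  have hc : c₁ = c₂ := by
    have := (mul_eq_zero.1 eB.1).resolve_right fun h =>
      hB (homCoords_injective_of_linear (row_ne_zero h₂ 0) h hB₂)
    linear_combination -this
  subst hc
  refine ⟨rfl, homCoords_injective_of_linear (row_ne_zero h₂ 0) ?_ hB₂,
    homCoords_injective_of_linear (row_ne_zero h₂ 1) hA₂ ?_⟩
  · refine (mul_eq_zero.1 eA.1).resolve_left fun h => hc₁ ?_
    linear_combination h / 2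
  · refine (mul_eq_zero.1 eB.2).resolve_left fun h => hc₁ ?_
    linear_combination -h / 2

end

end BryantSurface

end

/-! ### Conclusion: the two residues cancel. -/

theorem proposition6p2 {M : Type*} [TopologicalSpace M] [T2Space M] [SecondCountableTopology M]
    [ConnectedSpace M] [ChartedSpace ℂ M] [IsManifold 𝓘(ℂ) ω M]
    (X : M → BryantSurface.UpperHalfSpace) (E : Fin 2 → Set M)
    (hX : BryantSurface.IsCatenoidalSurface 2 X E)
    (μ₁ μ₂ : ℝ) (A₁ B₁ A₂ B₂ : OnePoint ℂ)
    (h₁ : BryantSurface.IsCatenoidalEnd X (E 0) μ₁ A₁ B₁)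
    (h₂ : BryantSurface.IsCatenoidalEnd X (E 1) μ₂ A₂ B₂)
    (hB : B₁ ≠ B₂) :
    μ₁ = μ₂ ∧ A₁ = B₂ ∧ A₂ = B₁ := by
  obtain ⟨hμ₁, hμ₁', Q₁, r₁, φ₁, H₁, hQ₁, hA₁, hB₁, hφ₁, hH₁⟩ := h₁.exists_residue hX.bryant
  obtain ⟨hμ₂, hμ₂', Q₂, r₂, φ₂, H₂, hQ₂, hA₂, hB₂, hφ₂, hH₂⟩ := h₂.exists_residue hX.bryant
  have hsum : ∀ i j, (1 - (μ₁ : ℂ) ^ 2) / 4 * BryantSurface.fluxMatrix Q₁ i j +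
      (1 - (μ₂ : ℂ) ^ 2) / 4 * BryantSurface.fluxMatrix Q₂ i j = 0 := by
    intro i j
    have := BryantSurface.sum_residue_eq_zero hX.bryant hX.disjoint hX.compact_compl
      (φ := ![φ₁, φ₂]) (r := ![r₁, r₂]) (h := ![fun z => H₁ z i j, fun z => H₂ z i j])
      (Fin.forall_fin_two.2 ⟨hφ₁, hφ₂⟩) i j
      (Fin.forall_fin_two.2 ⟨(hH₁ i j).1, (hH₂ i j).1⟩)
      (Fin.forall_fin_two.2 ⟨(hH₁ i j).2.2, (hH₂ i j).2.2⟩)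
    rw [Fin.sum_univ_two] at this
    rw [← (hH₁ i j).2.1, ← (hH₂ i j).2.1]
    exact this
  -- The flux of the first end does not vanish, because `μ₁ > 0` and `μ₁ ≠ 1`.
  have hne : (1 - (μ₁ : ℂ) ^ 2) / 4 ≠ 0 := by
    have : (1 - μ₁ ^ 2) / 4 ≠ 0 := by
      intro h0
      have : (1 - μ₁) * (1 + μ₁) = 0 := by linear_combination 4 * h0
      rcases mul_eq_zero.1 this with h | h
      · exact hμ₁' (by linarith)
      · linarith
    exact_mod_cast this
  obtain ⟨hc, hA, hA'⟩ := BryantSurface.axes_eq_of_flux_add_eq_zero hQ₁ hQ₂ hne hsum hA₁ hB₁ hA₂ hB₂ hB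
  refine ⟨?_, hA, hA'⟩
  have hsq : μ₁ ^ 2 = μ₂ ^ 2 := by
    have : (μ₁ : ℂ) ^ 2 = (μ₂ : ℂ) ^ 2 := by linear_combination -4 * hc
    exact_mod_cast this
  exact (pow_left_inj₀ hμ₁.le hμ₂.le two_ne_zero).1 hsq
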